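/- Let $\mathcal V$ be a complete symmetric monoidal closed category. Small $\mathcal V$-categories are those with a small set of objects; an index is a $\mathcal V$-functor $P:K\to\mathcal V$ with $K$ small. For a small $\mathcal V$-category $A$ and a presheaf (a $\mathcal V$-functor) $F:A^{op}\to\mathcal V$, say that $F$ is $\mathcal P_0$-flat if its (pointwise) left Kan extension $-*F:[A,\mathcal V]\to\mathcal V$ along the Yoneda embedding $Y:A^{op}\to[A,\mathcal V]$, $a\mapsto A(a,-)$, exists and preserves all weighted limits $\{P,G\}$, for all indexes $P:K\to\mathcal V$ and all $\mathcal V$-functors $G:K\to[A,\mathcal V]$. Let $I$ be the unit $\mathcal V$-category, with one object $*$ and $I(*,*)$ the tensor unit. A module $A\nrightarrow B$ is a $\mathcal V$-functor $B^{op}\otimes A\to\mathcal V$, and the composite of $M:A\nrightarrow B$ and $N:B\nrightarrow C$ is $(N\circ M)(c,a)=\int^{b}N(c,b)\otimes M(b,a)$. A module $M:A\nrightarrow B$ is a left adjoint if there is a module $N:B\nrightarrow A$ such that the composites $N\circ M$ and $M\circ N$ exist, together with module morphisms $1_A\to N\circ M$ and $M\circ N\to 1_B$ satisfying the triangle identities.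 Theorem. Let $A$ be a small $\mathcal V$-category. (a) For every presheaf $F:A^{op}\to\mathcal V$ the following are equivalent: (1) $F$ is $\mathcal P_0$-flat; (2) $F$, viewed as a module $I\nrightarrow A$, is a left adjoint. (b) Consequently the $\mathcal P_0$-completion of $A$, i.e. the full sub-$\mathcal V$-category of $[A^{op},\mathcal V]$ on the $\mathcal P_0$-flat presheaves, is the Cauchy completion of $A$, i.e. the full sub-$\mathcal V$-category of $[A^{op},\mathcal V]$ on the presheaves that are left adjoint modules $I\nrightarrow A$: there are mutually inverse $\mathcal V$-functors between the two which commute with the inclusions into $[A^{op},\mathcal V]$. -/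

import Mathlib

open CategoryTheory MonoidalCategory Limits Opposite
open scoped MonoidalClosed

set_option linter.unusedSectionVars false

universe w v u u₁ u₂ u₃

namespace EnrichedFlatness

noncomputable section

section Base

variable {V : Type u} [Category.{v} V] [MonoidalCategory V]

/-- The hom-object `C(x, y)` of a `V`-category. -/
abbrev EHom (V : Type u) [Category.{v} V] [MonoidalCategory V] {C : Type u₁}
    [EnrichedCategory V C] (x y : C) : V := EnrichedCategory.Hom x y

variable {C : Type u₁} [EnrichedCategory V C] {D : Type u₂} [EnrichedCategory V D]
  {E : Type u₃} [EnrichedCategory V E]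

/-- Composition of generalised elements of hom-objects. -/
abbrev ecmp {X Y : V} {a b c : C} (f : X ⟶ EHom V a b) (g : Y ⟶ EHom V b c) :
    X ⊗ Y ⟶ EHom V a c := (f ⊗ₘ g) ≫ eComp V a b c

lemma ecmp_assoc {X Y Z : V} {a b c d : C} (f : X ⟶ EHom V a b) (g : Y ⟶ EHom V b c)
    (h : Z ⟶ EHom V c d) : ecmp f (ecmp g h) = (α_ X Y Z).inv ≫ ecmp (ecmp f g) h := by
  have h1 : f ⊗ₘ (g ⊗ₘ h) ≫ eComp V b c d =
      (f ⊗ₘ g ⊗ₘ h) ≫ EHom V a b ◁ eComp V b c d := by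
    simp [MonoidalCategory.tensorHom_def]
  have h2 : ((f ⊗ₘ g) ≫ eComp V a b c) ⊗ₘ h =
      ((f ⊗ₘ g) ⊗ₘ h) ≫ eComp V a b c ▷ EHom V c d := by
    simp [MonoidalCategory.tensorHom_def']
  rw [ecmp, ecmp, h1, ecmp, ecmp, h2, Category.assoc, Category.assoc, ← e_assoc,
    associator_inv_naturality_assoc]

lemma ecmp_map (F : EnrichedFunctor V C D) {X Y : V} {a b c : C} (f : X ⟶ EHom V a b)
    (g : Y ⟶ EHom V b c) :
    ecmp f g ≫ F.map a c = ecmp (f ≫ F.map a b) (g ≫ F.map b c) := by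
  simp [ecmp]

lemma ecmp_id_left {X : V} {a b : C} (f : X ⟶ EHom V a b) :
    ecmp (eId V a) f = (λ_ X).hom ≫ f := by
  have := e_id_comp V a b
  rw [Iso.inv_comp_eq, Category.comp_id] at this
  simp [ecmp, MonoidalCategory.tensorHom_def', this]

lemma ecmp_id_right {X : V} {a b : C} (f : X ⟶ EHom V a b) :
    ecmp f (eId V b) = (ρ_ X).hom ≫ f := by
  have := e_comp_id V a b
  rw [Iso.inv_comp_eq, Category.comp_id] at this
  simp [ecmp, MonoidalCategory.tensorHom_def, this]

lemma ecmp_whisker {X Y X' Y' : V} {a b c : C} (x : X' ⟶ X) (y : Y' ⟶ Y) (f : X ⟶ EHom V a b)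
    (g : Y ⟶ EHom V b c) : ecmp (x ≫ f) (y ≫ g) = (x ⊗ₘ y) ≫ ecmp f g := by
  simp [ecmp]

variable [SymmetricCategory V]

/-- The opposite of a `V`-functor. -/
def opFunctor (G : EnrichedFunctor V C D) : EnrichedFunctor V Cᵒᵖ Dᵒᵖ where
  obj c := op (G.obj c.unop)
  map c c' := G.map c'.unop c.unop
  map_id c := G.map_id c.unop
  map_comp x y z := by
    have h := G.map_comp z.unop y.unop x.unop
    rw [eComp_op_eq, Category.assoc, h, tensorHom_eComp_op_eq]
    rfl

/-- A family `X ⟶ D(F c, G c)` in `V` is `V`-natural in `c`: the two composites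
`C(c, c') ⊗ X ⟶ D(F c, G c')` agree. -/
def IsVNatural (F G : EnrichedFunctor V C D) {X : V} (σ : ∀ c, X ⟶ EHom V (F.obj c) (G.obj c)) :
    Prop :=
  ∀ c c', ecmp (F.map c c') (σ c') = (β_ _ _).hom ≫ ecmp (σ c) (G.map c c')

lemma IsVNatural.precomp {F G : EnrichedFunctor V C D} {X Y : V}
    {σ : ∀ c, X ⟶ EHom V (F.obj c) (G.obj c)} (h : IsVNatural F G σ) (f : Y ⟶ X) :
    IsVNatural F G (fun c => f ≫ σ c) := fun c c' => by
  have h1 := ecmp_whisker (𝟙 _) f (F.map c c') (σ c')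
  have h2 := ecmp_whisker f (𝟙 _) (σ c) (G.map c c')
  rw [Category.id_comp] at h1 h2
  rw [h1, h2, h c c', BraidedCategory.braiding_naturality_assoc]

lemma isVNatural_id (F : EnrichedFunctor V C D) :
    IsVNatural F F (fun c => eId V (F.obj c)) := fun c c' => by
  rw [ecmp_id_left, ecmp_id_right]
  simp

lemma IsVNatural.comp {F G H : EnrichedFunctor V C D} {X Y : V}
    {σ : ∀ c, X ⟶ EHom V (F.obj c) (G.obj c)} {τ : ∀ c, Y ⟶ EHom V (G.obj c) (H.obj c)}
    (hσ : IsVNatural F G σ) (hτ : IsVNatural G H τ) :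
    IsVNatural F H (fun c => ecmp (σ c) (τ c)) := fun c c' => by
  have h1 := ecmp_whisker (β_ _ _).hom (𝟙 _) (ecmp (σ c) (G.map c c')) (τ c')
  have h2 := ecmp_whisker (𝟙 _) (β_ _ _).hom (σ c) (ecmp (τ c) (H.map c c'))
  rw [Category.id_comp] at h1 h2
  have h3 : ecmp (ecmp (σ c) (G.map c c')) (τ c') =
      (α_ _ _ _).hom ≫ ecmp (σ c) (ecmp (G.map c c') (τ c')) := by
    rw [ecmp_assoc, Iso.hom_inv_id_assoc]
  have h4 : ecmp (σ c) (ecmp (τ c) (H.map c c')) =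
      (α_ _ _ _).inv ≫ ecmp (ecmp (σ c) (τ c)) (H.map c c') := ecmp_assoc _ _ _
  calc ecmp (F.map c c') (ecmp (σ c') (τ c'))
      = (α_ _ _ _).inv ≫ ((β_ _ _).hom ⊗ₘ 𝟙 _) ≫ (α_ _ _ _).hom ≫
          (𝟙 _ ⊗ₘ (β_ _ _).hom) ≫ (α_ _ _ _).inv ≫
            ecmp (ecmp (σ c) (τ c)) (H.map c c') := by
        rw [ecmp_assoc, hσ c c', h1, h3, hτ c c', h2, h4]
    _ = (β_ _ _).hom ≫ ecmp (ecmp (σ c) (τ c)) (H.map c c') := by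
        rw [BraidedCategory.braiding_tensor_right_hom]
        simp

end Base
section FunctorCategory

variable {V : Type u} [Category.{v} V] [MonoidalCategory V] [SymmetricCategory V]
  [MonoidalClosed V] [HasLimitsOfSize.{w, w} V]
  {C : Type w} [EnrichedCategory V C] {D : Type u₂} [EnrichedCategory V D]

lemma hasEqualizers_of_complete (V : Type u) [Category.{v} V] [HasLimitsOfSize.{w, w} V] :
    HasEqualizers V :=
  have : HasLimitsOfSize.{0, 0} V := hasLimitsOfSizeShrink.{0, 0, w, w} V
  inferInstance

/-- `∏_c D(F c, G c)`. -/
abbrev natProd (F G : EnrichedFunctor V C D) : V := ∏ᶜ fun c : C => EHom V (F.obj c) (G.obj c)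

/-- `∏_{c, c'} [C(c, c'), D(F c, G c')]`. -/
abbrev natProd₂ (F G : EnrichedFunctor V C D) : V :=
  ∏ᶜ fun p : C × C => (ihom (EHom V p.1 p.2)).obj (EHom V (F.obj p.1) (G.obj p.2))

def natLeft (F G : EnrichedFunctor V C D) : natProd F G ⟶ natProd₂ F G :=
  Pi.lift fun p => MonoidalClosed.curry
    (ecmp (F.map p.1 p.2) (Pi.π (fun c : C => EHom V (F.obj c) (G.obj c)) p.2))

def natRight (F G : EnrichedFunctor V C D) : natProd F G ⟶ natProd₂ F G :=
  Pi.lift fun p => MonoidalClosed.curry ((β_ _ _).hom ≫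
    ecmp (Pi.π (fun c : C => EHom V (F.obj c) (G.obj c)) p.1) (G.map p.1 p.2))

/-- The object of `V`-natural transformations from `F` to `G`, i.e. the end `∫_c D(F c, G c)`. -/
def natObj (F G : EnrichedFunctor V C D) : V :=
  have := hasEqualizers_of_complete.{w} V
  equalizer (natLeft F G) (natRight F G)

/-- The component at `c` of the end `∫_c D(F c, G c)`. -/
def natπ (F G : EnrichedFunctor V C D) (c : C) : natObj F G ⟶ EHom V (F.obj c) (G.obj c) :=
  have := hasEqualizers_of_complete.{w} V
  equalizer.ι (natLeft F G) (natRight F G) ≫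
    Pi.π (fun c : C => EHom V (F.obj c) (G.obj c)) c

lemma isVNatural_iff (F G : EnrichedFunctor V C D) {X : V}
    (σ : ∀ c, X ⟶ EHom V (F.obj c) (G.obj c)) :
    IsVNatural F G σ ↔ Pi.lift σ ≫ natLeft F G = Pi.lift σ ≫ natRight F G := by
  have hl : ∀ c c', Pi.lift σ ≫ natLeft F G ≫ Pi.π _ (c, c') =
      MonoidalClosed.curry (ecmp (F.map c c') (σ c')) := fun c c' => by
    simp only [natLeft, Pi.lift_π]
    rw [← MonoidalClosed.curry_natural_left]
    simp [ecmp, MonoidalCategory.tensorHom_def', ← whiskerLeft_comp_assoc]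
  have hr : ∀ c c', Pi.lift σ ≫ natRight F G ≫ Pi.π _ (c, c') =
      MonoidalClosed.curry ((β_ _ _).hom ≫ ecmp (σ c) (G.map c c')) := fun c c' => by
    simp only [natRight, Pi.lift_π]
    rw [← MonoidalClosed.curry_natural_left]
    simp [ecmp, MonoidalCategory.tensorHom_def, ← comp_whiskerRight_assoc]
  constructor
  · intro h
    refine Pi.hom_ext _ _ fun p => ?_
    rw [Category.assoc, Category.assoc, hl p.1 p.2, hr p.1 p.2, h]
  · intro h c c'
    apply MonoidalClosed.curry_injective
    rw [← hl, ← hr, reassoc_of% h]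

lemma natπ_natural (F G : EnrichedFunctor V C D) : IsVNatural F G (natπ F G) := by
  have := hasEqualizers_of_complete.{w} V
  rw [isVNatural_iff]
  have : Pi.lift (natπ F G) = equalizer.ι (natLeft F G) (natRight F G) :=
    Pi.hom_ext _ _ fun c => by simp [natπ]
  rw [this]
  exact equalizer.condition _ _

/-- The universal property of the object of `V`-natural transformations. -/
def natLift {F G : EnrichedFunctor V C D} {X : V} (σ : ∀ c, X ⟶ EHom V (F.obj c) (G.obj c))
    (h : IsVNatural F G σ) : X ⟶ natObj F G :=
  have := hasEqualizers_of_complete.{w} V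
  equalizer.lift (Pi.lift σ) ((isVNatural_iff F G σ).1 h)

@[simp]
lemma natLift_π {F G : EnrichedFunctor V C D} {X : V} (σ : ∀ c, X ⟶ EHom V (F.obj c) (G.obj c))
    (h : IsVNatural F G σ) (c : C) : natLift σ h ≫ natπ F G c = σ c := by
  have := hasEqualizers_of_complete.{w} V
  exact (equalizer.lift_ι_assoc _ _ _).trans (Pi.lift_π _ _)

lemma nat_hom_ext {F G : EnrichedFunctor V C D} {X : V} {f g : X ⟶ natObj F G}
    (h : ∀ c, f ≫ natπ F G c = g ≫ natπ F G c) : f = g := by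
  have := hasEqualizers_of_complete.{w} V
  refine equalizer.hom_ext (Pi.hom_ext _ _ fun c => ?_)
  exact (Category.assoc _ _ _).trans ((h c).trans (Category.assoc _ _ _).symm)

/-- Vertical composition of `V`-natural transformations. -/
def natComp (F G H : EnrichedFunctor V C D) : natObj F G ⊗ natObj G H ⟶ natObj F H :=
  natLift (fun c => ecmp (natπ F G c) (natπ G H c))
    ((natπ_natural F G).comp (natπ_natural G H))

@[simp]
lemma natComp_π (F G H : EnrichedFunctor V C D) (c : C) :
    natComp F G H ≫ natπ F H c = ecmp (natπ F G c) (natπ G H c) := natLift_π _ _ c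

lemma ecmp_natComp {F G H : EnrichedFunctor V C D} {X Y : V} (f : X ⟶ natObj F G)
    (g : Y ⟶ natObj G H) (c : C) : ((f ⊗ₘ g) ≫ natComp F G H) ≫ natπ F H c =
      ecmp (f ≫ natπ F G c) (g ≫ natπ G H c) := by
  rw [Category.assoc, natComp_π, ecmp_whisker]

/-- The `V`-category `[C, D]` of `V`-functors from a small `V`-category `C`. -/
instance functorCategory : EnrichedCategory V (EnrichedFunctor V C D) where
  Hom F G := natObj F G
  id F := natLift _ (isVNatural_id F)
  comp F G H := natComp F G H
  id_comp F G := nat_hom_ext fun c => by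
    rw [← tensorHom_id, Category.assoc, ecmp_natComp, natLift_π, ecmp_id_left]
    simp
  comp_id F G := nat_hom_ext fun c => by
    rw [← id_tensorHom, Category.assoc, ecmp_natComp, natLift_π, ecmp_id_right]
    simp
  assoc F G H K := nat_hom_ext fun c => by
    rw [← id_tensorHom, ← tensorHom_id, Category.assoc, ecmp_natComp, ecmp_natComp,
      natComp_π, natComp_π, Category.id_comp, Category.id_comp, ecmp_assoc]

lemma eId_natπ (F : EnrichedFunctor V C D) (c : C) :
    eId V F ≫ natπ F F c = eId V (F.obj c) :=
  natLift_π _ (isVNatural_id F) c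

lemma ecmp_natπ {F G H : EnrichedFunctor V C D} {X Y : V} (f : X ⟶ EHom V F G)
    (g : Y ⟶ EHom V G H) (c : C) :
    ecmp f g ≫ natπ F H c = ecmp (f ≫ natπ F G c) (g ≫ natπ G H c) :=
  ecmp_natComp f g c

end FunctorCategory

section Representables

variable {V : Type u} [Category.{v} V] [MonoidalCategory V] [SymmetricCategory V]
  [MonoidalClosed V]
  {K : Type u₁} [EnrichedCategory V K] {B : Type u₂} [EnrichedCategory V B]
  {D : Type u₃} [EnrichedCategory V D]

lemma ecmp_curry {x y z P Q : V} (f : x ⊗ P ⟶ y) (g : y ⊗ Q ⟶ z) :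
    ecmp (V := V) (a := x) (b := y) (c := z) (MonoidalClosed.curry f) (MonoidalClosed.curry g) =
      MonoidalClosed.curry ((α_ x P Q).inv ≫ f ▷ Q ≫ g) := by
  apply MonoidalClosed.uncurry_injective
  rw [MonoidalClosed.uncurry_curry]
  change MonoidalClosed.uncurry ((_ ⊗ₘ _) ≫ MonoidalClosed.comp x y z) = _
  rw [MonoidalClosed.comp_eq, ← MonoidalClosed.curry_natural_left, MonoidalClosed.uncurry_curry,
    MonoidalClosed.compTranspose_eq, MonoidalCategory.tensorHom_def,
    MonoidalCategory.whiskerLeft_comp, Category.assoc, associator_inv_naturality_right_assoc,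
    associator_inv_naturality_middle_assoc, whisker_exchange_assoc]
  have h := MonoidalClosed.uncurry_curry f
  have h' := MonoidalClosed.uncurry_curry g
  rw [MonoidalClosed.uncurry_eq] at h h'
  rw [← comp_whiskerRight_assoc]
  erw [h, h']

/-- The representable `V`-functor `B(b, -) : B ⟶ V`. -/
def coyo (b : B) : EnrichedFunctor V B V where
  obj c := EHom V b c
  map c c' := MonoidalClosed.curry (eComp V b c c')
  map_id c := by
    rw [← MonoidalClosed.curry_natural_left]
    have := e_comp_id V b c
    rw [Iso.inv_comp_eq, Category.comp_id] at this
    rw [this]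
    rfl
  map_comp c c' c'' := by
    have := ecmp_curry (eComp V b c c') (eComp V b c' c'')
    rw [← MonoidalClosed.curry_natural_left, ← e_assoc V b c c' c'', ← this]

/-- The morphism `B(b', b) ⟶ [B(b, c), B(b', c)]` corresponding to composition. -/
def coyoMap (b b' c : B) : EHom V b' b ⟶ EHom V ((coyo (V := V) b).obj c) ((coyo b').obj c) :=
  MonoidalClosed.curry ((β_ (EHom V b c) (EHom V b' b)).hom ≫ eComp V b' b c)

lemma coyoMap_natural (b b' : B) :
    IsVNatural (coyo (V := V) b) (coyo b') (coyoMap b b') := fun c c' => by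
  have h1 := ecmp_curry (eComp V b c c') ((β_ (EHom V b c') (EHom V b' b)).hom ≫ eComp V b' b c')
  have h2 := ecmp_curry ((β_ (EHom V b c) (EHom V b' b)).hom ≫ eComp V b' b c) (eComp V b' c c')
  refine h1.trans (Eq.trans ?_ (congrArg (fun t => (β_ _ _).hom ≫ t) h2.symm))
  rw [← MonoidalClosed.curry_natural_left]
  refine congrArg MonoidalClosed.curry (?_ : (α_ (EHom V b c) (EHom V c c') (EHom V b' b)).inv ≫
    eComp V b c c' ▷ EHom V b' b ≫ (β_ (EHom V b c') (EHom V b' b)).hom ≫ eComp V b' b c' =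
    EHom V b c ◁ (β_ (EHom V c c') (EHom V b' b)).hom ≫ (α_ _ _ _).inv ≫
      ((β_ (EHom V b c) (EHom V b' b)).hom ≫ eComp V b' b c) ▷ EHom V c c' ≫ eComp V b' c c')
  rw [BraidedCategory.braiding_naturality_left_assoc, ← e_assoc, comp_whiskerRight,
    BraidedCategory.braiding_tensor_left_hom]
  simp [e_assoc']

lemma eId_coyoMap (b c : B) : eId V b ≫ coyoMap b b c = eId V ((coyo (V := V) b).obj c) := by
  have := e_id_comp V b c
  rw [Iso.inv_comp_eq, Category.comp_id] at this
  refine (MonoidalClosed.curry_natural_left _ _).symm.trans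
    (congrArg MonoidalClosed.curry (?_ : _ = (ρ_ (EHom V b c)).hom))
  refine (BraidedCategory.braiding_naturality_right_assoc _ _ _).trans ?_
  exact (congrArg (fun t => (β_ (EHom V b c) (𝟙_ V)).hom ≫ t) this).trans
    (braiding_leftUnitor _)

lemma eComp_coyoMap (x y z c : B) : ((β_ _ _).hom ≫ eComp V z y x) ≫ coyoMap x z c =
    ecmp (coyoMap (V := V) x y c) (coyoMap (V := V) y z c) := by
  refine Eq.trans (MonoidalClosed.curry_natural_left _ _).symm
    (Eq.trans (congrArg MonoidalClosed.curry ?_) (ecmp_curry _ _).symm)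
  change EHom V x c ◁ ((β_ (EHom V y x) (EHom V z y)).hom ≫ eComp V z y x) ≫
      (β_ (EHom V x c) (EHom V z x)).hom ≫ eComp V z x c =
    (α_ (EHom V x c) (EHom V y x) (EHom V z y)).inv ≫
      ((β_ (EHom V x c) (EHom V y x)).hom ≫ eComp V y x c) ▷ EHom V z y ≫
        (β_ (EHom V y c) (EHom V z y)).hom ≫ eComp V z y c
  rw [MonoidalCategory.whiskerLeft_comp, Category.assoc,
    BraidedCategory.braiding_naturality_right_assoc,
    BraidedCategory.braiding_naturality_right_assoc, comp_whiskerRight, Category.assoc,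
    BraidedCategory.braiding_naturality_left_assoc, ← e_assoc,
    BraidedCategory.braiding_tensor_left_hom, BraidedCategory.braiding_tensor_right_hom]
  simp [e_assoc']

lemma IsVNatural.whisker {F F' : EnrichedFunctor V B D} {X : V}
    {σ : ∀ b, X ⟶ EHom V (F.obj b) (F'.obj b)} (h : IsVNatural F F' σ)
    (G : EnrichedFunctor V K B) :
    IsVNatural (G.comp V F) (G.comp V F') (fun k => σ (G.obj k)) := fun k k' => by
  have h1 := ecmp_whisker (G.map k k') (𝟙 _) (F.map _ _) (σ (G.obj k'))
  have h2 := ecmp_whisker (𝟙 _) (G.map k k') (σ (G.obj k)) (F'.map _ _)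
  rw [Category.id_comp] at h1 h2
  refine h1.trans (Eq.trans ?_ (congrArg (fun t => (β_ _ _).hom ≫ t) h2.symm))
  rw [h, BraidedCategory.braiding_naturality_assoc]

end Representables

section WeightedLimits

variable {V : Type u} [Category.{v} V] [MonoidalCategory V] [SymmetricCategory V]
  [MonoidalClosed V] [HasLimitsOfSize.{w, w} V]
  {K : Type w} [EnrichedCategory V K] {B : Type u₂} [EnrichedCategory V B]
  {D : Type u₃} [EnrichedCategory V D]

/-- The morphism `B(b', b) ⟶ [K, V](B(b, G -), B(b', G -))` corresponding to composition. -/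
def nerveMap (G : EnrichedFunctor V K B) (b b' : B) :
    EHom V b' b ⟶ EHom V (G.comp V (coyo b)) (G.comp V (coyo b')) :=
  natLift (F := G.comp V (coyo b)) (G := G.comp V (coyo b'))
    (fun k => coyoMap b b' (G.obj k)) ((coyoMap_natural b b').whisker G)

lemma nerveMap_π (G : EnrichedFunctor V K B) (b b' : B) (k : K) :
    nerveMap G b b' ≫ natπ (G.comp V (coyo b)) (G.comp V (coyo b')) k =
      coyoMap b b' (G.obj k) :=
  natLift_π _ _ k

/-- The Yoneda embedding `Aᵒᵖ ⟶ [A, V]`, `a ↦ A(a, -)`. -/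
def yonedaV (A : Type w) [EnrichedCategory V A] :
    EnrichedFunctor V Aᵒᵖ (EnrichedFunctor V A V) where
  obj a := coyo a.unop
  map a a' := natLift (coyoMap a.unop a'.unop) (coyoMap_natural a.unop a'.unop)
  map_id b := nat_hom_ext fun k =>
    (Category.assoc _ _ _).trans <| (congrArg (eId V b ≫ ·) (natLift_π _ _ k)).trans <|
      (eId_coyoMap b.unop k).trans (eId_natπ _ k).symm
  map_comp x y z := nat_hom_ext fun k =>
    (Category.assoc _ _ _).trans <| (congrArg (eComp V x y z ≫ ·) (natLift_π _ _ k)).trans <|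
      (eComp_coyoMap _ _ _ _).trans <| ((ecmp_natπ
        (natLift (coyoMap x.unop y.unop) (coyoMap_natural x.unop y.unop))
        (natLift (coyoMap y.unop z.unop) (coyoMap_natural y.unop z.unop)) k).trans
        (congrArg₂ ecmp (natLift_π _ _ k) (natLift_π _ _ k))).symm

/-- A cone with vertex `L` on `G : K ⟶ B` weighted by `P : K ⟶ V`: a `V`-natural transformation
`P ⟶ B(L, G -)`, given as a morphism `𝟙_ V ⟶ [K, V](P, B(L, G -))`. -/
abbrev WeightedCone (P : EnrichedFunctor V K V) (G : EnrichedFunctor V K B) (L : B) :=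
  𝟙_ V ⟶ EHom V P (G.comp V (coyo L))

/-- The morphism `B(b, L) ⟶ [K, V](P, B(b, G -))` induced by a cone with vertex `L`. -/
def WeightedCone.comparison {P : EnrichedFunctor V K V} {G : EnrichedFunctor V K B} {L : B}
    (η : WeightedCone P G L) (b : B) : EHom V b L ⟶ EHom V P (G.comp V (coyo b)) :=
  (λ_ _).inv ≫ ecmp η (nerveMap G L b)

/-- The cone `η` exhibits `L` as the limit `{P, G}` of `G` weighted by `P`. -/
def WeightedCone.IsLimit {P : EnrichedFunctor V K V} {G : EnrichedFunctor V K B} {L : B}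
    (η : WeightedCone P G L) : Prop :=
  ∀ b : B, IsIso (η.comparison b)

lemma mapCone_natural (T : EnrichedFunctor V B D) (G : EnrichedFunctor V K B) (L : B) :
    IsVNatural (G.comp V (coyo L)) ((G.comp V T).comp V (coyo (T.obj L)))
      (X := 𝟙_ V) (fun k => MonoidalClosed.curry' (X := EHom V L (G.obj k))
        (Y := EHom V (T.obj L) (T.obj (G.obj k))) (T.map L (G.obj k))) := fun k k' => by
  have h0 : ((G.comp V (coyo L)).map k k') = MonoidalClosed.curry
      (EHom V L (G.obj k) ◁ G.map k k' ≫ eComp V L (G.obj k) (G.obj k')) :=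
    (MonoidalClosed.curry_natural_left _ _).symm
  have h0' : (((G.comp V T).comp V (coyo (T.obj L))).map k k') = MonoidalClosed.curry
      (EHom V (T.obj L) (T.obj (G.obj k)) ◁ (G.map k k' ≫ T.map (G.obj k) (G.obj k')) ≫
        eComp V (T.obj L) (T.obj (G.obj k)) (T.obj (G.obj k'))) :=
    (MonoidalClosed.curry_natural_left _ _).symm
  rw [h0, h0']
  refine (ecmp_curry _ _).trans (Eq.trans ?_
    (congrArg (fun t => (β_ _ _).hom ≫ t) (ecmp_curry _ _).symm))
  rw [← MonoidalClosed.curry_natural_left]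
  refine congrArg MonoidalClosed.curry ?_
  change (α_ (EHom V L (G.obj k)) (EHom V k k') (𝟙_ V)).inv ≫
      (EHom V L (G.obj k) ◁ G.map k k' ≫ eComp V L (G.obj k) (G.obj k')) ▷ 𝟙_ V ≫
        (ρ_ (EHom V L (G.obj k'))).hom ≫ T.map L (G.obj k') =
    EHom V L (G.obj k) ◁ (β_ (EHom V k k') (𝟙_ V)).hom ≫
      (α_ (EHom V L (G.obj k)) (𝟙_ V) (EHom V k k')).inv ≫
      ((ρ_ (EHom V L (G.obj k))).hom ≫ T.map L (G.obj k)) ▷ EHom V k k' ≫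
      EHom V (T.obj L) (T.obj (G.obj k)) ◁ (G.map k k' ≫ T.map (G.obj k) (G.obj k')) ≫
        eComp V (T.obj L) (T.obj (G.obj k)) (T.obj (G.obj k'))
  have h1 := T.map_comp L (G.obj k) (G.obj k')
  simp only [MonoidalCategory.whiskerRight_id, MonoidalCategory.tensorHom_def, Category.assoc,
    comp_whiskerRight, MonoidalCategory.whiskerLeft_comp, Iso.inv_hom_id_assoc] at h1 ⊢
  rw [← whisker_exchange_assoc, ← h1]
  simp

/-- The image of a weighted cone under a `V`-functor `T`:
the composite `P ⟶ B(L, G -) ⟶ D(T L, T G -)`. -/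
def WeightedCone.map {P : EnrichedFunctor V K V} {G : EnrichedFunctor V K B} {L : B}
    (η : WeightedCone P G L) (T : EnrichedFunctor V B D) :
    WeightedCone P (G.comp V T) (T.obj L) :=
  (λ_ _).inv ≫ ecmp η (natLift _ (mapCone_natural T G L))

/-- `T` preserves the limits of `G` weighted by `P`. -/
def PreservesWeightedLimit (T : EnrichedFunctor V B D) (P : EnrichedFunctor V K V)
    (G : EnrichedFunctor V K B) : Prop :=
  ∀ (L : B) (η : WeightedCone P G L), η.IsLimit → (η.map T).IsLimit

end WeightedLimits

section KanExtensions

variable {V : Type u} [Category.{v} V] [MonoidalCategory V] [SymmetricCategory V]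
  {C : Type u₁} [EnrichedCategory V C] {B : Type u₂} [EnrichedCategory V B]
  {D : Type u₃} [EnrichedCategory V D]

lemma IsVNatural.postcomp {F G : EnrichedFunctor V C B} {X : V}
    {σ : ∀ c, X ⟶ EHom V (F.obj c) (G.obj c)} (h : IsVNatural F G σ)
    (T : EnrichedFunctor V B D) :
    IsVNatural (F.comp V T) (G.comp V T) (fun c => σ c ≫ T.map (F.obj c) (G.obj c)) :=
  fun c c' => by
    have h1 := ecmp_map T (F.map c c') (σ c')
    have h2 := ecmp_map T (σ c) (G.map c c')
    rw [h, Category.assoc, h2] at h1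
    exact h1.symm

lemma IsVNatural.opp {F G : EnrichedFunctor V C B} {X : V}
    {σ : ∀ c, X ⟶ EHom V (F.obj c) (G.obj c)} (h : IsVNatural F G σ) :
    IsVNatural (opFunctor G) (opFunctor F) (fun c : Cᵒᵖ => σ c.unop) := fun c c' => by
  have h1 := h c'.unop c.unop
  have h2 : ecmp (C := Bᵒᵖ) (a := op (G.obj c.unop)) (b := op (G.obj c'.unop))
      (c := op (F.obj c'.unop)) (G.map c'.unop c.unop) (σ c'.unop) =
      (β_ _ _).hom ≫ ecmp (σ c'.unop) (G.map c'.unop c.unop) := tensorHom_eComp_op_eq V _ _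
  have h3 : ecmp (C := Bᵒᵖ) (a := op (G.obj c.unop)) (b := op (F.obj c.unop))
      (c := op (F.obj c'.unop)) (σ c.unop) (F.map c'.unop c.unop) =
      (β_ _ _).hom ≫ ecmp (F.map c'.unop c.unop) (σ c.unop) := tensorHom_eComp_op_eq V _ _
  refine h2.trans (Eq.trans ?_ (congrArg (fun t => (β_ _ _).hom ≫ t) h3.symm))
  rw [h1]
  simp

end KanExtensions

section Flatness

variable {V : Type u} [Category.{v} V] [MonoidalCategory V] [SymmetricCategory V]
  [MonoidalClosed V] [HasLimitsOfSize.{w, w} V]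
  {C : Type w} [EnrichedCategory V C] {B : Type u₂} [EnrichedCategory V B]
  {D : Type u₃} [EnrichedCategory V D]

/-- For `K : C ⟶ D`, `F : C ⟶ B`, `L : D ⟶ B` and a `V`-natural `φ : F ⟶ L K`, the composite
`D(K -, d) ⟶ B(L K -, L d) ⟶ B(F -, L d)`. It is a cocone on `F` with vertex `L d` weighted by
`D(K -, d) : Cᵒᵖ ⟶ V`, that is, a cone on `Fᵒᵖ : Cᵒᵖ ⟶ Bᵒᵖ` with that weight. -/
def kanCocone (K : EnrichedFunctor V C D) (F : EnrichedFunctor V C B)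
    (L : EnrichedFunctor V D B) (φ : 𝟙_ V ⟶ EHom V F (K.comp V L)) (d : D) :
    WeightedCone ((opFunctor K).comp V (coyo (op d))) (opFunctor F) (op (L.obj d)) :=
  (λ_ _).inv ≫ ecmp
    (b := ((opFunctor K).comp V (opFunctor L)).comp V (coyo (op (L.obj d))))
    (natLift _ (mapCone_natural (opFunctor L) (opFunctor K) (op d)))
    (natLift _ ((((natπ_natural F (K.comp V L)).precomp φ).opp).postcomp (coyo (op (L.obj d)))))

/-- `φ : F ⟶ L K` exhibits `L` as the (pointwise) left Kan extension of `F` along `K`: for each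
`d`, the object `L d` is the colimit of `F` weighted by `D(K -, d)`. (A colimit in `B` is a limit
in `Bᵒᵖ`.) -/
def IsLeftKanExtension (K : EnrichedFunctor V C D) (F : EnrichedFunctor V C B)
    (L : EnrichedFunctor V D B) (φ : 𝟙_ V ⟶ EHom V F (K.comp V L)) : Prop :=
  ∀ d : D, (kanCocone K F L φ d).IsLimit

variable (V) in
/-- A class of (small) indexes `K ⟶ V`. -/
abbrev IndexClass := ∀ (K : Type w) [EnrichedCategory V K], EnrichedFunctor V K V → Prop

variable (V) in
/-- The class of all indexes. -/
def allIndexes : IndexClass.{w} V := fun _ _ _ => True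

/-- `F : Aᵒᵖ ⟶ V` is `Φ`-flat: its left Kan extension along the Yoneda embedding
`Aᵒᵖ ⟶ [A, V]` exists and preserves all limits with index in `Φ`. -/
def IsFlat (Φ : IndexClass.{w} V) {A : Type w} [EnrichedCategory V A]
    (F : EnrichedFunctor V Aᵒᵖ V) : Prop :=
  ∃ (L : EnrichedFunctor V (EnrichedFunctor V A V) V)
    (φ : 𝟙_ V ⟶ EHom V F ((yonedaV A).comp V L)),
    IsLeftKanExtension (yonedaV A) F L φ ∧
      ∀ (K : Type w) [EnrichedCategory V K] (W : EnrichedFunctor V K V), Φ K W →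
        ∀ G : EnrichedFunctor V K (EnrichedFunctor V A V), PreservesWeightedLimit L W G

end Flatness

section Modules

variable (V : Type u) [Category.{v} V] [MonoidalCategory V]

/-- A `V`-module `A ⇸ B`, i.e. a `V`-functor `Bᵒᵖ ⊗ A ⟶ V`, presented by its two actions. -/
structure VModule (A : Type u₁) [EnrichedCategory V A] (B : Type u₂) [EnrichedCategory V B] where
  obj : B → A → V
  lact : ∀ b b' a, EHom V b b' ⊗ obj b' a ⟶ obj b a
  ract : ∀ b a a', obj b a ⊗ EHom V a a' ⟶ obj b a'
  id_lact : ∀ b a, eId V b ▷ obj b a ≫ lact b b a = (λ_ _).hom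
  comp_lact : ∀ b b' b'' a, eComp V b b' b'' ▷ obj b'' a ≫ lact b b'' a =
    (α_ _ _ _).hom ≫ EHom V b b' ◁ lact b' b'' a ≫ lact b b' a
  ract_id : ∀ b a, obj b a ◁ eId V a ≫ ract b a a = (ρ_ _).hom
  ract_comp : ∀ b a a' a'', obj b a ◁ eComp V a a' a'' ≫ ract b a a'' =
    (α_ _ _ _).inv ≫ ract b a a' ▷ EHom V a' a'' ≫ ract b a' a''
  lact_ract : ∀ b b' a a', lact b b' a ▷ EHom V a a' ≫ ract b a a' =
    (α_ _ _ _).hom ≫ EHom V b b' ◁ ract b' a a' ≫ lact b b' a'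

variable {V}
variable {A : Type u₁} [EnrichedCategory V A] {B : Type u₂} [EnrichedCategory V B]
  {C : Type u₃} [EnrichedCategory V C]

namespace VModule

/-- A morphism of `V`-modules. -/
structure Hom (M N : VModule V A B) where
  app : ∀ b a, M.obj b a ⟶ N.obj b a
  lact_app : ∀ b b' a, M.lact b b' a ≫ app b a = EHom V b b' ◁ app b' a ≫ N.lact b b' a
  ract_app : ∀ b a a', M.ract b a a' ≫ app b a' = app b a ▷ EHom V a a' ≫ N.ract b a a'

variable (V A) in
/-- The identity module `A ⇸ A`, with values `A(a, a')`. -/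
def idModule : VModule V A A where
  obj a a' := EHom V a a'
  lact a a' a'' := eComp V a a' a''
  ract a a' a'' := eComp V a a' a''
  id_lact a a' := by
    have := e_id_comp V a a'
    rwa [Iso.inv_comp_eq, Category.comp_id] at this
  comp_lact a b c d := (e_assoc' V a b c d).symm
  ract_id a a' := by
    have := e_comp_id V a a'
    rwa [Iso.inv_comp_eq, Category.comp_id] at this
  ract_comp a b c d := (e_assoc V a b c d).symm
  lact_ract a b c d := (e_assoc' V a b c d).symm

/-- A composite `N ∘ M : A ⇸ C` of modules `M : A ⇸ B` and `N : B ⇸ C`: a module whose value at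
`(c, a)` is the coend `∫^b N(c, b) ⊗ M(b, a)`, with the actions induced by those of `N`, `M`. -/
structure Composite (N : VModule V B C) (M : VModule V A B) where
  comp : VModule V A C
  ι : ∀ c b a, N.obj c b ⊗ M.obj b a ⟶ comp.obj c a
  balanced : ∀ c b b' a, N.ract c b b' ▷ M.obj b' a ≫ ι c b' a =
    (α_ _ _ _).hom ≫ N.obj c b ◁ M.lact b b' a ≫ ι c b a
  ι_lact : ∀ c c' b a, EHom V c c' ◁ ι c' b a ≫ comp.lact c c' a =
    (α_ _ _ _).inv ≫ N.lact c c' b ▷ M.obj b a ≫ ι c b a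
  ι_ract : ∀ c b a a', ι c b a ▷ EHom V a a' ≫ comp.ract c a a' =
    (α_ _ _ _).hom ≫ N.obj c b ◁ M.ract b a a' ≫ ι c b a'
  desc : ∀ (c : C) (a : A) (X : V) (f : ∀ b, N.obj c b ⊗ M.obj b a ⟶ X),
    (∀ b b', N.ract c b b' ▷ M.obj b' a ≫ f b' =
      (α_ _ _ _).hom ≫ N.obj c b ◁ M.lact b b' a ≫ f b) →
    ∃! g : comp.obj c a ⟶ X, ∀ b, ι c b a ≫ g = f b

/-- An adjunction `M ⊣ N` between modules `M : A ⇸ B` and `N : B ⇸ A`: a unit `1_A ⟶ N ∘ M` and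
a counit `M ∘ N ⟶ 1_B` satisfying the triangle identities.

In `left_triangle`, `t` is the component on `M(b, a) ⊗ (N ∘ M)(a, a')` of the composite
`M ∘ (N ∘ M) ≅ (M ∘ N) ∘ M ⟶ 1_B ∘ M ≅ M`; similarly for `s` in `right_triangle`. -/
structure Adjunction (M : VModule V A B) (N : VModule V B A) where
  NM : Composite N M
  MN : Composite M N
  unit : Hom (idModule V A) NM.comp
  counit : Hom MN.comp (idModule V B)
  left_triangle : ∀ b a a', ∃ t : M.obj b a ⊗ NM.comp.obj a a' ⟶ M.obj b a',
    (∀ b', M.obj b a ◁ NM.ι a b' a' ≫ t = (α_ _ _ _).inv ≫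
      (MN.ι b a b' ≫ counit.app b b') ▷ M.obj b' a' ≫ M.lact b b' a') ∧
    M.obj b a ◁ unit.app a a' ≫ t = M.ract b a a'
  right_triangle : ∀ a a' b, ∃ s : NM.comp.obj a a' ⊗ N.obj a' b ⟶ N.obj a b,
    (∀ b', NM.ι a b' a' ▷ N.obj a' b ≫ s = (α_ _ _ _).hom ≫
      N.obj a b' ◁ (MN.ι b' a' b ≫ counit.app b' b) ≫ N.ract a b' b) ∧
    unit.app a a' ▷ N.obj a' b ≫ s = N.lact a a' b

/-- `M : A ⇸ B` is a left adjoint: it has a right adjoint module `B ⇸ A`. -/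
def IsLeftAdjoint (M : VModule V A B) : Prop :=
  ∃ N : VModule V B A, Nonempty (Adjunction M N)

end VModule

/-- The object type of the unit `V`-category `I`: one object `*`, with `I(*, *) = 𝟙_ V`. -/
def UnitVCat : Type := Unit

instance : EnrichedCategory V UnitVCat where
  Hom _ _ := 𝟙_ V
  id _ := 𝟙 _
  comp _ _ _ := (λ_ (𝟙_ V)).hom
  id_comp _ _ := by simp
  comp_id _ _ := by simp [unitors_equal]
  assoc _ _ _ _ := by simp [unitors_equal]

end Modules

section Completions

variable {V : Type u} [Category.{v} V] [MonoidalCategory V] [SymmetricCategory V]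
  [MonoidalClosed V]

lemma braiding_action {P Q X Y Z : V} (u : X ⊗ Q ⟶ Y) (u' : Y ⊗ P ⟶ Z) :
    (β_ (P ⊗ Q) X).hom ≫ X ◁ (β_ P Q).hom ≫ (α_ X Q P).inv ≫ u ▷ P ≫ u' =
      (α_ P Q X).hom ≫ P ◁ ((β_ Q X).hom ≫ u) ≫ (β_ P Y).hom ≫ u' := by
  simp only [BraidedCategory.braiding_tensor_left_hom, MonoidalCategory.whiskerLeft_comp,
    Category.assoc]
  rw [BraidedCategory.braiding_naturality_right_assoc, BraidedCategory.braiding_tensor_right_hom]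
  simp

/-- A presheaf `F : Aᵒᵖ ⟶ V` viewed as a module `I ⇸ A`. -/
def presheafModule {A : Type u₁} [EnrichedCategory V A] (F : EnrichedFunctor V Aᵒᵖ V) :
    VModule V UnitVCat A where
  obj a _ := F.obj (op a)
  lact a a' _ := (β_ _ _).hom ≫ MonoidalClosed.uncurry (F.map (op a') (op a))
  ract a _ _ := (ρ_ (F.obj (op a))).hom
  id_lact a _ := by
    have h : eId V a ≫ F.map (op a) (op a) = MonoidalClosed.curry (ρ_ _).hom := F.map_id (op a)
    rw [BraidedCategory.braiding_naturality_left_assoc, ← MonoidalClosed.uncurry_natural_left, h,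
      MonoidalClosed.uncurry_curry]
    simp
  comp_lact a a' a'' _ := by
    have h1 : ((β_ (EHom V a' a'') (EHom V a a')).hom ≫ eComp V a a' a'') ≫
        F.map (op a'') (op a) = ecmp (F.map (op a'') (op a')) (F.map (op a') (op a)) :=
      F.map_comp (op a'') (op a') (op a)
    have h2 := ecmp_curry (MonoidalClosed.uncurry (F.map (op a'') (op a')))
      (MonoidalClosed.uncurry (F.map (op a') (op a)))
    have h3 : eComp V a a' a'' ≫ F.map (op a'') (op a) =
        (β_ (EHom V a a') (EHom V a' a'')).hom ≫
          ecmp (F.map (op a'') (op a')) (F.map (op a') (op a)) := by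
      rw [← h1]; simp
    rw [MonoidalClosed.curry_uncurry, MonoidalClosed.curry_uncurry] at h2
    rw [BraidedCategory.braiding_naturality_left_assoc, ← MonoidalClosed.uncurry_natural_left, h3,
      h2, MonoidalClosed.uncurry_natural_left, MonoidalClosed.uncurry_curry]
    exact braiding_action _ _
  ract_id a _ := by
    change _ ◁ 𝟙 _ ≫ (ρ_ _).hom = _
    simp
  ract_comp a _ _ _ := by
    change _ ◁ (λ_ _).hom ≫ (ρ_ _).hom =
      (α_ _ (𝟙_ V) (𝟙_ V)).inv ≫ (ρ_ _).hom ▷ 𝟙_ V ≫ (ρ_ _).hom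
    rw [← MonoidalCategory.triangle_assoc, Iso.inv_hom_id_assoc]
  lact_ract a a' _ _ := by
    change _ ▷ 𝟙_ V ≫ (ρ_ _).hom = (α_ _ _ (𝟙_ V)).hom ≫ _ ◁ (ρ_ _).hom ≫ _
    simp

/-- The objects of the full sub-`V`-category of `B` determined by `p`. -/
def FullSub {B : Type u₁} (p : B → Prop) := {b : B // p b}

instance {B : Type u₁} [EnrichedCategory V B] (p : B → Prop) :
    EnrichedCategory V (FullSub p) where
  Hom x y := EHom V x.1 y.1
  id x := eId V x.1
  comp x y z := eComp V x.1 y.1 z.1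
  id_comp x y := e_id_comp V x.1 y.1
  comp_id x y := e_comp_id V x.1 y.1
  assoc x y z t := e_assoc V x.1 y.1 z.1 t.1

/-- The inclusion of a full sub-`V`-category. -/
def FullSub.incl {B : Type u₁} [EnrichedCategory V B] (p : B → Prop) :
    EnrichedFunctor V (FullSub p) B where
  obj x := x.1
  map x y := 𝟙 (EHom V x.1 y.1)
  map_id x := Category.comp_id _
  map_comp x y z := by
    change eComp V x.1 y.1 z.1 ≫ 𝟙 _ =
      (𝟙 (EHom V x.1 y.1) ⊗ₘ 𝟙 (EHom V y.1 z.1)) ≫ eComp V x.1 y.1 z.1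
    simp

variable [HasLimitsOfSize.{w, w} V]

/-- The `Φ`-completion `Flat_Φ(A)` of `A`: the full sub-`V`-category of `[Aᵒᵖ, V]` on the
`Φ`-flat presheaves. -/
abbrev FlatCompletion (Φ : IndexClass.{w} V) (A : Type w) [EnrichedCategory V A] :=
  FullSub fun F : EnrichedFunctor V Aᵒᵖ V => IsFlat Φ F

variable (V) in
/-- The Cauchy completion of `A`: the full sub-`V`-category of `[Aᵒᵖ, V]` on the presheaves which
are left adjoint modules `I ⇸ A`. -/
abbrev CauchyCompletion (A : Type w) [EnrichedCategory V A] :=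
  FullSub fun F : EnrichedFunctor V Aᵒᵖ V => (presheafModule F).IsLeftAdjoint

end Completions

end
end EnrichedFlatness

open EnrichedFlatness

/-!
The left Kan extension of a presheaf `F` along the Yoneda embedding `Y : Aᵒᵖ ⟶ [A, V]` takes
`G : A ⟶ V` to the coend `∫^a G a ⊗ F a` (`isLimit_kanCocone_iff_isCoend`).

If `F` has a right adjoint module `N`, regarded as a `V`-functor `A ⟶ V`, then this coend exists and
is `[A, V](N, G)`: in one direction, evaluate a natural transformation on the unit
`𝟙_ V ⟶ ∫^a N a ⊗ F a`; in the other, use the counit `F b ⊗ N a ⟶ A(b, a)` and the action of `A`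
on `G` (`DualPair.isCoend_nat`). Hence the Kan extension is the representable `[A, V](N, -)`, and
representables preserve all weighted limits (`preservesWeightedLimit_coyo`).

Conversely, preservation of one limit suffices. Let `N a = [Aᵒᵖ, V](F, A(-, a))`. Evaluation is a
pairing `F b ⊗ N a ⟶ A(b, a)`, the future counit, and its transposes `F b ⟶ [A, V](N, Y b)` exhibit
`N` as the limit of `Y` weighted by `F` (`isLimit_dualPairing`). If the Kan extension `L` preserves
this limit, then `V`-natural transformations `F ⟶ L Y` correspond to morphisms `𝟙_ V ⟶ L N`. The
unit of the Kan extension is such a transformation, and `L N` is the coend `∫^a N a ⊗ F a`, so it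
gives the unit of an adjunction between `F` and `N` (`exists_dualUnit`). The triangle identities
follow since the unit of the Kan extension is invertible, `Y` being fully faithful
(`isIso_kanUnit`, `nonempty_dualPair`).

The two full sub-`V`-categories then have the same objects.

To keep braidings out of the arguments, a generalised element `X ⟶ [x, y]` is handled through its
transposes `X ⊗ x ⟶ y` and `x ⊗ X ⟶ y`, whichever respects the order of the variables at hand, and
composition is used in both orders (`ecmp`, `rc`).
-/

namespace EnrichedFlatness

noncomputable section

/-! ### Transposes of generalised elements of internal homs -/

section Calculus

variable {V : Type u} [Category.{v} V] [MonoidalCategory V] [SymmetricCategory V]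
  {C : Type u₁} [EnrichedCategory V C] {D : Type u₂} [EnrichedCategory V D]

/-- Composition of generalised elements of hom-objects in the classical order (`g` after `f`). -/
def rc {X Y : V} {a b c : C} (g : Y ⟶ EHom V b c) (f : X ⟶ EHom V a b) : Y ⊗ X ⟶ EHom V a c :=
  (β_ Y X).hom ≫ ecmp f g

lemma braiding_rc {X Y : V} {a b c : C} (g : Y ⟶ EHom V b c) (f : X ⟶ EHom V a b) :
    (β_ X Y).hom ≫ rc g f = ecmp f g := by
  simp [rc]

lemma rc_whisker {X Y X' Y' : V} {a b c : C} (y : Y' ⟶ Y) (x : X' ⟶ X) (g : Y ⟶ EHom V b c)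
    (f : X ⟶ EHom V a b) : rc (y ≫ g) (x ≫ f) = (y ⊗ₘ x) ≫ rc g f := by
  rw [rc, ecmp_whisker, rc, BraidedCategory.braiding_naturality_assoc]

lemma rc_whiskerLeft {X Y X' : V} {a b c : C} (x : X' ⟶ X) (g : Y ⟶ EHom V b c)
    (f : X ⟶ EHom V a b) : rc g (x ≫ f) = Y ◁ x ≫ rc g f := by
  simpa using rc_whisker (𝟙 Y) x g f

lemma rc_whiskerRight {X Y Y' : V} {a b c : C} (y : Y' ⟶ Y) (g : Y ⟶ EHom V b c)
    (f : X ⟶ EHom V a b) : rc (y ≫ g) f = y ▷ X ≫ rc g f := by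
  simpa using rc_whisker y (𝟙 X) g f

lemma rc_map (F : EnrichedFunctor V C D) {X Y : V} {a b c : C} (g : Y ⟶ EHom V b c)
    (f : X ⟶ EHom V a b) :
    rc g f ≫ F.map a c = rc (g ≫ F.map b c) (f ≫ F.map a b) := by
  rw [rc, Category.assoc, ecmp_map, rc]

/-- `rc` is composition in the opposite `V`-category. -/
lemma ecmp_op {X Y : V} {a b c : C} (g : Y ⟶ EHom V b c) (f : X ⟶ EHom V a b) :
    ecmp (C := Cᵒᵖ) (a := op c) (b := op b) (c := op a) g f = rc g f :=
  tensorHom_eComp_op_eq V _ _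

variable [MonoidalClosed V]

/-- The transpose `x ⊗ X ⟶ y` of a generalised element of `[x, y]`. -/
def rf {X x y : V} (f : X ⟶ EHom V x y) : x ⊗ X ⟶ y := MonoidalClosed.uncurry f

/-- The transpose `X ⊗ x ⟶ y` of a generalised element of `[x, y]`. -/
def lf {X x y : V} (f : X ⟶ EHom V x y) : X ⊗ x ⟶ y := (β_ X x).hom ≫ rf f

/-- The inverse of `rf`. -/
def rfInv {X x y : V} (f : x ⊗ X ⟶ y) : X ⟶ EHom V x y := MonoidalClosed.curry f

/-- The inverse of `lf`. -/
def lfInv {X x y : V} (f : X ⊗ x ⟶ y) : X ⟶ EHom V x y := rfInv ((β_ x X).hom ≫ f)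

@[simp] lemma rf_rfInv {X x y : V} (f : x ⊗ X ⟶ y) : rf (rfInv f) = f :=
  MonoidalClosed.uncurry_curry f

@[simp] lemma rfInv_rf {X x y : V} (f : X ⟶ EHom V x y) : rfInv (rf f) = f :=
  MonoidalClosed.curry_uncurry f

@[simp] lemma lf_lfInv {X x y : V} (f : X ⊗ x ⟶ y) : lf (lfInv f) = f := by
  simp [lf, lfInv]

@[simp] lemma lfInv_lf {X x y : V} (f : X ⟶ EHom V x y) : lfInv (lf f) = f := by
  simp [lf, lfInv]

lemma braiding_lf {X x y : V} (f : X ⟶ EHom V x y) : (β_ x X).hom ≫ lf f = rf f := by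
  simp [lf]

lemma rf_injective {X x y : V} {f g : X ⟶ EHom V x y} (h : rf f = rf g) : f = g := by
  rw [← rfInv_rf f, h, rfInv_rf]

lemma lf_injective {X x y : V} {f g : X ⟶ EHom V x y} (h : lf f = lf g) : f = g := by
  rw [← lfInv_lf f, h, lfInv_lf]

lemma rf_comp {X X' x y : V} (h : X' ⟶ X) (f : X ⟶ EHom V x y) :
    rf (h ≫ f) = x ◁ h ≫ rf f :=
  MonoidalClosed.uncurry_natural_left h f

lemma lf_comp {X X' x y : V} (h : X' ⟶ X) (f : X ⟶ EHom V x y) :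
    lf (h ≫ f) = h ▷ x ≫ lf f := by
  simp [lf, rf_comp]

lemma rf_ecmp {X Y x y z : V} (f : X ⟶ EHom V x y) (g : Y ⟶ EHom V y z) :
    rf (ecmp f g) = (α_ x X Y).inv ≫ rf f ▷ Y ≫ rf g := by
  have h := ecmp_curry (rf f) (rf g)
  have hf : MonoidalClosed.curry (rf f) = f := rfInv_rf f
  have hg : MonoidalClosed.curry (rf g) = g := rfInv_rf g
  rw [hf, hg] at h
  exact (congrArg rf h).trans (rf_rfInv _)

lemma lf_rc {X Y x y z : V} (g : Y ⟶ EHom V y z) (f : X ⟶ EHom V x y) :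
    lf (rc g f) = (α_ Y X x).hom ≫ Y ◁ lf f ≫ lf g := by
  rw [rc, lf_comp, lf, rf_ecmp, lf, lf, BraidedCategory.braiding_naturality_left_assoc,
    BraidedCategory.braiding_tensor_left_hom]
  simp

lemma rf_eId (x : V) : rf (eId V x) = (ρ_ x).hom := rf_rfInv _

lemma lf_eId (x : V) : lf (eId V x) = (λ_ x).hom := by
  rw [lf, rf_eId, braiding_rightUnitor]

/-- The left action `C(c, c') ⊗ F c ⟶ F c'` of a `V`-valued `V`-functor. -/
def la (F : EnrichedFunctor V C V) (c c' : C) : EHom V c c' ⊗ F.obj c ⟶ F.obj c' :=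
  lf (F.map c c')

/-- The right action `F c ⊗ C(c, c') ⟶ F c'` of a `V`-valued `V`-functor. -/
def ra (F : EnrichedFunctor V C V) (c c' : C) : F.obj c ⊗ EHom V c c' ⟶ F.obj c' :=
  rf (F.map c c')

/-- `V`-naturality for families `X ⟶ [P c, Q c]`, in terms of the transposes `X ⊗ P c ⟶ Q c`. -/
lemma isVNatural_iff_lf {P Q : EnrichedFunctor V C V} {X : V}
    (σ : ∀ c, X ⟶ EHom V (P.obj c) (Q.obj c)) :
    IsVNatural P Q σ ↔ ∀ c c', X ◁ ra P c c' ≫ lf (σ c') =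
      (α_ _ _ _).inv ≫ lf (σ c) ▷ EHom V c c' ≫ ra Q c c' := by
  refine forall₂_congr fun c c' => ?_
  have key : (ecmp (P.map c c') (σ c') = (β_ _ _).hom ≫ ecmp (σ c) (Q.map c c')) ↔
      rc (σ c') (P.map c c') = (β_ _ _).hom ≫ rc (Q.map c c') (σ c) := by
    rw [braiding_rc, rc, ← cancel_epi (β_ X (EHom V c c')).hom]
    simp
  have e1 : X ◁ (β_ _ _).hom ≫ (α_ _ _ _).inv ≫ lf (rc (σ c') (P.map c c')) =
      X ◁ ra P c c' ≫ lf (σ c') := by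
    rw [lf_rc, Iso.inv_hom_id_assoc, ← MonoidalCategory.whiskerLeft_comp_assoc, braiding_lf, ra]
  have e2 : X ◁ (β_ _ _).hom ≫ (α_ _ _ _).inv ≫
        lf ((β_ _ _).hom ≫ rc (Q.map c c') (σ c)) =
      (α_ _ _ _).inv ≫ lf (σ c) ▷ EHom V c c' ≫ ra Q c c' := by
    rw [lf_comp, lf_rc, ra, ← braiding_lf, BraidedCategory.braiding_naturality_left_assoc,
      BraidedCategory.braiding_tensor_left_hom]
    simp
  rw [key, ← e1, ← e2]
  constructor
  · intro h; rw [h]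
  · intro h
    rw [cancel_epi, cancel_epi] at h
    exact lf_injective h

/-- `V`-naturality for families `X ⟶ [P c, Q c]`, in terms of the transposes `P c ⊗ X ⟶ Q c`. -/
lemma isVNatural_iff_rf {P Q : EnrichedFunctor V C V} {X : V}
    (σ : ∀ c, X ⟶ EHom V (P.obj c) (Q.obj c)) :
    IsVNatural P Q σ ↔ ∀ c c', la P c c' ▷ X ≫ rf (σ c') =
      (α_ _ _ _).hom ≫ EHom V c c' ◁ rf (σ c) ≫ la Q c c' := by
  refine forall₂_congr fun c c' => ?_
  have e1 : (β_ (EHom V c c') (P.obj c)).hom ▷ X ≫ (α_ _ _ _).hom ≫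
      rf (ecmp (P.map c c') (σ c')) = la P c c' ▷ X ≫ rf (σ c') := by
    rw [rf_ecmp, Iso.hom_inv_id_assoc, ← comp_whiskerRight_assoc, la, lf]
  have e2 : (β_ (EHom V c c') (P.obj c)).hom ▷ X ≫ (α_ _ _ _).hom ≫
      rf ((β_ _ _).hom ≫ ecmp (σ c) (Q.map c c')) =
      (α_ _ _ _).hom ≫ EHom V c c' ◁ rf (σ c) ≫ la Q c c' := by
    rw [rf_comp, rf_ecmp, la, lf, BraidedCategory.braiding_naturality_right_assoc,
      BraidedCategory.braiding_tensor_right_hom]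
    simp
  rw [← e1, ← e2]
  constructor
  · intro h; rw [h]
  · intro h
    rw [cancel_epi, cancel_epi] at h
    exact rf_injective h

end Calculus

/-! ### Weighted limits in terms of generalised elements -/

section Representable

variable {V : Type u} [Category.{v} V] [MonoidalCategory V] [SymmetricCategory V]
  [MonoidalClosed V]
  {K : Type u₁} [EnrichedCategory V K] {B : Type u₂} [EnrichedCategory V B]

lemma ecmp_eq {X Y : V} {a b c : B} (f : X ⟶ EHom V a b) (g : Y ⟶ EHom V b c) :
    ecmp f g = f ▷ Y ≫ ecmp (𝟙 _) g := by
  simp [ecmp, MonoidalCategory.tensorHom_def]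

lemma ecmp_id_whisker {Y : V} {a b c : B} (g : Y ⟶ EHom V b c) :
    ecmp (𝟙 (EHom V a b)) g = EHom V a b ◁ g ≫ eComp V a b c := by
  simp [ecmp]

lemma rc_eq {X Y : V} {a b c : B} (g : Y ⟶ EHom V b c) (f : X ⟶ EHom V a b) :
    rc g f = Y ◁ f ≫ rc g (𝟙 _) := by
  rw [← rc_whiskerLeft, Category.comp_id]

lemma ra_coyo (b c c' : B) : ra (coyo (V := V) b) c c' = eComp V b c c' := rf_rfInv _

lemma la_coyo (b c c' : B) :
    la (coyo (V := V) b) c c' = rc (𝟙 (EHom V c c')) (𝟙 (EHom V b c)) := by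
  have h : (β_ (EHom V c c') (EHom V b c)).hom ≫ eComp V b c c' =
      rc (𝟙 (EHom V c c')) (𝟙 (EHom V b c)) := by
    simp [rc, ecmp]
  exact (congrArg ((β_ (EHom V c c') (EHom V b c)).hom ≫ ·) (ra_coyo b c c')).trans h

lemma lf_coyoMap (b b' c : B) : lf (coyoMap (V := V) b b' c) = eComp V b' b c :=
  lf_lfInv _

lemma ra_comp_coyo (G : EnrichedFunctor V K B) (b : B) (k k' : K) :
    ra (G.comp V (coyo b)) k k' = ecmp (𝟙 (EHom V b (G.obj k))) (G.map k k') := by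
  refine (rf_comp (G.map k k') ((coyo b).map (G.obj k) (G.obj k'))).trans ?_
  refine (congrArg (EHom V b (G.obj k) ◁ G.map k k' ≫ ·) (ra_coyo b (G.obj k) (G.obj k'))).trans ?_
  exact (ecmp_id_whisker _).symm

lemma la_comp_coyo (G : EnrichedFunctor V K B) (b : B) (k k' : K) :
    la (G.comp V (coyo b)) k k' = rc (G.map k k') (𝟙 (EHom V b (G.obj k))) :=
  congrArg ((β_ _ _).hom ≫ ·) (ra_comp_coyo G b k k')

end Representable

section WeightedLimits

variable {V : Type u} [Category.{v} V] [MonoidalCategory V] [SymmetricCategory V]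
  [MonoidalClosed V] [HasLimitsOfSize.{w, w} V]
  {K : Type w} [EnrichedCategory V K] {B : Type u₂} [EnrichedCategory V B]
  {D : Type u₃} [EnrichedCategory V D]
  {P : EnrichedFunctor V K V} {G : EnrichedFunctor V K B} {L : B}

/-- The underlying morphism `F c ⟶ G c` of a global element of `[C, V](F, G)`. -/
def gapp {F G : EnrichedFunctor V K V} (φ : 𝟙_ V ⟶ EHom V F G) (c : K) : F.obj c ⟶ G.obj c :=
  (λ_ _).inv ≫ lf (φ ≫ natπ F G c)

lemma lf_gapp {F G : EnrichedFunctor V K V} (φ : 𝟙_ V ⟶ EHom V F G) (c : K) :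
    lf (φ ≫ natπ F G c) = (λ_ _).hom ≫ gapp φ c := by
  simp [gapp]

/-- The component `P k ⟶ B(L, G k)` of a weighted cone. -/
def WeightedCone.app (η : WeightedCone P G L) (k : K) : P.obj k ⟶ EHom V L (G.obj k) :=
  gapp η k

lemma lf_ecmp_unit {X p x y : V} (q : 𝟙_ V ⟶ EHom V p x) (c : X ⟶ EHom V x y) :
    lf ((λ_ X).inv ≫ ecmp q c) = X ◁ ((λ_ _).inv ≫ lf q) ≫ lf c := by
  rw [← braiding_rc, lf_comp, lf_comp, lf_rc]
  simp

lemma lf_comparison (η : WeightedCone P G L) (b : B) (k : K) :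
    lf (η.comparison b ≫ natπ P (G.comp V (coyo b)) k) =
      ecmp (𝟙 (EHom V b L)) (η.app k) := by
  have h1 : η.comparison b ≫ natπ P (G.comp V (coyo b)) k =
      (λ_ _).inv ≫ ecmp (η ≫ natπ P (G.comp V (coyo L)) k) (coyoMap L b (G.obj k)) := by
    refine (Category.assoc _ _ _).trans (congrArg ((λ_ _).inv ≫ ·) ?_)
    exact (ecmp_natπ _ _ k).trans (congrArg _ (nerveMap_π G L b k))
  refine (congrArg lf h1).trans ((lf_ecmp_unit _ _).trans ?_)
  exact (congrArg (EHom V b L ◁ η.app k ≫ ·) (lf_coyoMap _ _ _)).trans (ecmp_id_whisker _).symm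

lemma lf_comp_comparison (η : WeightedCone P G L) {b : B} {X : V} (g : X ⟶ EHom V b L) (k : K) :
    lf ((g ≫ η.comparison b) ≫ natπ P (G.comp V (coyo b)) k) = ecmp g (η.app k) := by
  rw [Category.assoc, lf_comp, lf_comparison]
  exact (ecmp_eq g (η.app k)).symm

lemma rf_comp_comparison (η : WeightedCone P G L) {b : B} {X : V} (g : X ⟶ EHom V b L) (k : K) :
    rf ((g ≫ η.comparison b) ≫ natπ P (G.comp V (coyo b)) k) = rc (η.app k) g := by
  rw [← braiding_lf, lf_comp_comparison]
  rfl

lemma isLimit_iff_bijective (η : WeightedCone P G L) :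
    η.IsLimit ↔ ∀ (b : B) (X : V) (σ : X ⟶ EHom V P (G.comp V (coyo b))),
      ∃! g : X ⟶ EHom V b L, g ≫ η.comparison b = σ := by
  refine forall_congr' fun b => (isIso_iff_yoneda_map_bijective _).trans ?_
  exact forall_congr' fun X => Function.bijective_iff_existsUnique _

/-- The universal property of a weighted limit, with generalised elements written as
`X ⊗ P k ⟶ B(b, G k)`. -/
lemma isLimit_iff_left (η : WeightedCone P G L) :
    η.IsLimit ↔ ∀ (b : B) (X : V) (τ : ∀ k, X ⊗ P.obj k ⟶ EHom V b (G.obj k)),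
      (∀ k k', X ◁ ra P k k' ≫ τ k' = (α_ _ _ _).inv ≫ ecmp (τ k) (G.map k k')) →
      ∃! g : X ⟶ EHom V b L, ∀ k, ecmp g (η.app k) = τ k := by
  rw [isLimit_iff_bijective]
  refine forall₂_congr fun b X => ?_
  have hn : ∀ (τ : ∀ k, X ⊗ P.obj k ⟶ EHom V b (G.obj k)) (k k' : K),
      ecmp (τ k) (G.map k k') = τ k ▷ EHom V k k' ≫ ra (G.comp V (coyo b)) k k' := fun τ k k' => by
    exact (ecmp_eq _ _).trans (congrArg (τ k ▷ EHom V k k' ≫ ·) (ra_comp_coyo G b k k').symm)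
  constructor
  · intro h τ hτ
    have e : ∀ k, lf (y := (G.comp V (coyo b)).obj k) (lfInv (τ k)) = τ k := fun k => lf_lfInv _
    have nat : IsVNatural P (G.comp V (coyo b)) (fun k => lfInv (τ k)) :=
      (isVNatural_iff_lf _).2 fun k k' => by
        rw [e, e]
        exact (hτ k k').trans (congrArg ((α_ X (P.obj k) (EHom V k k')).inv ≫ ·) (hn τ k k'))
    obtain ⟨g, hg, hu⟩ := h (natLift _ nat)
    refine ⟨g, fun k => ?_, fun g' hg' => hu g' (nat_hom_ext fun k => lf_injective ?_)⟩
    · rw [← lf_comp_comparison, hg, natLift_π]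
      exact e k
    · rw [lf_comp_comparison, natLift_π]
      exact (hg' k).trans (e k).symm
  · intro h σ
    obtain ⟨g, hg, hu⟩ := h (fun k => lf (σ ≫ natπ P (G.comp V (coyo b)) k)) fun k k' =>
      ((isVNatural_iff_lf _).1 ((natπ_natural P (G.comp V (coyo b))).precomp σ) k k').trans
        (congrArg ((α_ X (P.obj k) (EHom V k k')).inv ≫ ·)
          (hn (fun k => lf (σ ≫ natπ P (G.comp V (coyo b)) k)) k k').symm)
    refine ⟨g, nat_hom_ext fun k => lf_injective ?_, fun g' hg' => hu g' fun k => ?_⟩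
    · exact (lf_comp_comparison η g k).trans (hg k)
    · rw [← lf_comp_comparison]
      exact congrArg (fun t => lf (t ≫ natπ _ _ k)) hg'

/-- The universal property of a weighted limit, with generalised elements written as
`P k ⊗ X ⟶ B(b, G k)`. -/
lemma isLimit_iff_right (η : WeightedCone P G L) :
    η.IsLimit ↔ ∀ (b : B) (X : V) (τ : ∀ k, P.obj k ⊗ X ⟶ EHom V b (G.obj k)),
      (∀ k k', la P k k' ▷ X ≫ τ k' = (α_ _ _ _).hom ≫ rc (G.map k k') (τ k)) →
      ∃! g : X ⟶ EHom V b L, ∀ k, rc (η.app k) g = τ k := by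
  rw [isLimit_iff_bijective]
  refine forall₂_congr fun b X => ?_
  have hn : ∀ (τ : ∀ k, P.obj k ⊗ X ⟶ EHom V b (G.obj k)) (k k' : K),
      rc (G.map k k') (τ k) = EHom V k k' ◁ τ k ≫ la (G.comp V (coyo b)) k k' := fun τ k k' => by
    exact (rc_eq _ _).trans (congrArg (EHom V k k' ◁ τ k ≫ ·) (la_comp_coyo G b k k').symm)
  constructor
  · intro h τ hτ
    have e : ∀ k, rf (y := (G.comp V (coyo b)).obj k) (rfInv (τ k)) = τ k := fun k => rf_rfInv _
    have nat : IsVNatural P (G.comp V (coyo b)) (fun k => rfInv (τ k)) :=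
      (isVNatural_iff_rf _).2 fun k k' => by
        rw [e, e]
        exact (hτ k k').trans (congrArg ((α_ (EHom V k k') (P.obj k) X).hom ≫ ·) (hn τ k k'))
    obtain ⟨g, hg, hu⟩ := h (natLift _ nat)
    refine ⟨g, fun k => ?_, fun g' hg' => hu g' (nat_hom_ext fun k => rf_injective ?_)⟩
    · rw [← rf_comp_comparison, hg, natLift_π]
      exact e k
    · rw [rf_comp_comparison, natLift_π]
      exact (hg' k).trans (e k).symm
  · intro h σ
    obtain ⟨g, hg, hu⟩ := h (fun k => rf (σ ≫ natπ P (G.comp V (coyo b)) k)) fun k k' =>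
      ((isVNatural_iff_rf _).1 ((natπ_natural P (G.comp V (coyo b))).precomp σ) k k').trans
        (congrArg ((α_ (EHom V k k') (P.obj k) X).hom ≫ ·)
          (hn (fun k => rf (σ ≫ natπ P (G.comp V (coyo b)) k)) k k').symm)
    refine ⟨g, nat_hom_ext fun k => rf_injective ?_, fun g' hg' => hu g' fun k => ?_⟩
    · exact (rf_comp_comparison η g k).trans (hg k)
    · rw [← rf_comp_comparison]
      exact congrArg (fun t => rf (t ≫ natπ _ _ k)) hg'

lemma gapp_comp {F G H : EnrichedFunctor V K V} (φ : 𝟙_ V ⟶ EHom V F G) (ψ : 𝟙_ V ⟶ EHom V G H)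
    (c : K) : gapp ((λ_ _).inv ≫ ecmp φ ψ) c = gapp φ c ≫ gapp ψ c := by
  have h : ((λ_ _).inv ≫ ecmp φ ψ) ≫ natπ F H c =
      (λ_ _).inv ≫ ecmp (φ ≫ natπ F G c) (ψ ≫ natπ G H c) :=
    (Category.assoc _ _ _).trans (congrArg _ (ecmp_natπ φ ψ c))
  rw [gapp, h, ← braiding_rc, lf_comp, lf_comp, lf_rc, lf_gapp, lf_gapp]
  simp

lemma gapp_natLift {F G : EnrichedFunctor V K V}
    (σ : ∀ c, 𝟙_ V ⟶ EHom V (F.obj c) (G.obj c)) (h : IsVNatural F G σ) (c : K) :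
    gapp (natLift σ h) c = (λ_ _).inv ≫ lf (σ c) := by
  rw [gapp, natLift_π]

lemma lf_curry' {x y : V} (f : x ⟶ y) :
    lf (MonoidalClosed.curry' f : 𝟙_ V ⟶ EHom V x y) = (λ_ _).hom ≫ f := by
  have : rf (MonoidalClosed.curry' f : 𝟙_ V ⟶ EHom V x y) = (ρ_ _).hom ≫ f := rf_rfInv _
  rw [lf, this, braiding_rightUnitor_assoc]

lemma WeightedCone.map_app (η : WeightedCone P G L) (T : EnrichedFunctor V B D) (k : K) :
    (η.map T).app k = η.app k ≫ T.map L (G.obj k) := by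
  refine (gapp_comp _ _ k).trans (congrArg (gapp η k ≫ ·) ?_)
  refine (gapp_natLift _ _ k).trans ?_
  exact (congrArg _ (lf_curry' _)).trans (Iso.inv_hom_id_assoc _ _)

lemma pentagon_aux {p q r s z : V} (m : (p ⊗ (q ⊗ r)) ⊗ s ⟶ z) :
    (α_ p q (r ⊗ s)).hom ≫ p ◁ (α_ q r s).inv ≫ (α_ p (q ⊗ r) s).inv ≫ m =
      (α_ (p ⊗ q) r s).inv ≫ ((α_ p q r).hom ⊗ₘ 𝟙 s) ≫ m := by
  simp

/-- Composition with a representable `V`-functor, in terms of transposes. -/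
lemma rf_ecmp_coyo (b : B) {x X Y : V} {c c' : B} (g : X ⟶ EHom V x (EHom V b c))
    (f : Y ⟶ EHom V c c') :
    rf (y := EHom V b c') (ecmp (a := x) (b := (coyo (V := V) b).obj c)
      (c := (coyo (V := V) b).obj c') g (f ≫ (coyo b).map c c')) =
      (α_ x X Y).inv ≫ ecmp (rf g) f := by
  have h : rf (f ≫ (coyo b).map c c') = EHom V b c ◁ f ≫ eComp V b c c' :=
    (rf_comp _ _).trans (congrArg (EHom V b c ◁ f ≫ ·) (ra_coyo b c c'))
  refine (rf_ecmp (y := (coyo (V := V) b).obj c) (z := (coyo (V := V) b).obj c')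
    g (f ≫ (coyo b).map c c')).trans ?_
  refine (congrArg (fun t => (α_ x X Y).inv ≫ rf g ▷ Y ≫ t) h).trans ?_
  rw [ecmp_eq (rf g), ecmp_id_whisker]
  rfl

/-- Representable `V`-functors preserve all weighted limits. -/
lemma preservesWeightedLimit_coyo (b : B) (P : EnrichedFunctor V K V)
    (G : EnrichedFunctor V K B) : PreservesWeightedLimit (coyo (V := V) b) P G := by
  intro L η hη
  rw [isLimit_iff_left] at hη ⊢
  intro x X
  change ∀ τ : ∀ k, X ⊗ P.obj k ⟶ EHom V x (EHom V b (G.obj k)), _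
  intro τ hτ
  have hτ' : ∀ k k', (x ⊗ X) ◁ ra P k k' ≫ (α_ _ _ _).hom ≫ rf (τ k') =
      (α_ _ _ _).inv ≫ ecmp ((α_ _ _ _).hom ≫ rf (τ k)) (G.map k k') := fun k k' => by
    have h := (rf_comp _ (τ k')).symm.trans ((congrArg rf (hτ k k')).trans ((rf_comp _ _).trans
      (congrArg (x ◁ (α_ _ _ _).inv ≫ ·) (rf_ecmp_coyo b (τ k) (G.map k k')))))
    have h3 := ecmp_whisker (α_ x X (P.obj k)).hom (𝟙 (EHom V k k')) (rf (τ k)) (G.map k k')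
    rw [Category.id_comp] at h3
    rw [h3, tensor_whiskerLeft_assoc, Iso.inv_hom_id_assoc]
    exact (congrArg ((α_ _ _ _).hom ≫ ·) h).trans (pentagon_aux _)
  obtain ⟨g, hg, hu⟩ := hη b (x ⊗ X) (fun k => (α_ _ _ _).hom ≫ rf (τ k)) hτ'
  have key : ∀ (g' : X ⟶ EHom V x (EHom V b L)) (k : K),
      rf (y := EHom V b (G.obj k)) (ecmp (a := x) (b := (coyo (V := V) b).obj L) g'
        ((η.map (coyo b)).app k)) = (α_ _ _ _).inv ≫ ecmp (rf g') (η.app k) := fun g' k => by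
    rw [WeightedCone.map_app]
    exact rf_ecmp_coyo b g' (η.app k)
  refine ⟨rfInv g, fun k => rf_injective ?_, fun g' hg' => rf_injective ?_⟩
  · refine (key (rfInv g) k).trans ?_
    rw [rf_rfInv, hg, Iso.inv_hom_id_assoc]
    rfl
  · refine Eq.trans (hu (rf g') fun k => ?_) (rf_rfInv g).symm
    have h := (key g' k).symm.trans (congrArg rf (hg' k))
    rw [Iso.inv_comp_eq] at h
    exact h

end WeightedLimits

/-! ### Modules of natural transformations, and coends -/

section Action

variable {V : Type u} [Category.{v} V] [MonoidalCategory V] [SymmetricCategory V]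
  [MonoidalClosed V] {C : Type u₁} [EnrichedCategory V C]

lemma ra_comp (F : EnrichedFunctor V C V) (a b c : C) :
    F.obj a ◁ eComp V a b c ≫ ra F a c = (α_ _ _ _).inv ≫ ra F a b ▷ EHom V b c ≫ ra F b c := by
  have h := congrArg rf (F.map_comp a b c)
  rw [rf_comp] at h
  exact h.trans (rf_ecmp _ _)

lemma ra_id (F : EnrichedFunctor V C V) (a : C) :
    F.obj a ◁ eId V a ≫ ra F a a = (ρ_ _).hom := by
  rw [ra, ← rf_comp, F.map_id, rf_eId]

end Action

section NaturalTransformations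

variable {V : Type u} [Category.{v} V] [MonoidalCategory V] [SymmetricCategory V]
  [MonoidalClosed V] [HasLimitsOfSize.{w, w} V]
  {C : Type w} [EnrichedCategory V C] {F G H : EnrichedFunctor V C V}

/-- The component at `c` of a generalised element of `[C, V](F, G)`, acting from the left. -/
def lapp {X : V} (f : X ⟶ EHom V F G) (c : C) : X ⊗ F.obj c ⟶ G.obj c := lf (f ≫ natπ F G c)

/-- The component at `c` of a generalised element of `[C, V](F, G)`, acting from the right. -/
def rapp {X : V} (f : X ⟶ EHom V F G) (c : C) : F.obj c ⊗ X ⟶ G.obj c := rf (f ≫ natπ F G c)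

lemma lapp_ext {X : V} {f g : X ⟶ EHom V F G} (h : ∀ c, lapp f c = lapp g c) : f = g :=
  nat_hom_ext fun c => lf_injective (h c)

lemma rapp_ext {X : V} {f g : X ⟶ EHom V F G} (h : ∀ c, rapp f c = rapp g c) : f = g :=
  nat_hom_ext fun c => rf_injective (h c)

lemma lapp_comp {X Y : V} (h : Y ⟶ X) (f : X ⟶ EHom V F G) (c : C) :
    lapp (h ≫ f) c = h ▷ F.obj c ≫ lapp f c := by
  rw [lapp, Category.assoc, lf_comp, lapp]

lemma rapp_comp {X Y : V} (h : Y ⟶ X) (f : X ⟶ EHom V F G) (c : C) :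
    rapp (h ≫ f) c = F.obj c ◁ h ≫ rapp f c := by
  rw [rapp, Category.assoc, rf_comp, rapp]

lemma lapp_natural {X : V} (f : X ⟶ EHom V F G) (c c' : C) :
    X ◁ ra F c c' ≫ lapp f c' = (α_ _ _ _).inv ≫ lapp f c ▷ EHom V c c' ≫ ra G c c' :=
  (isVNatural_iff_lf _).1 ((natπ_natural F G).precomp f) c c'

lemma rapp_natural {X : V} (f : X ⟶ EHom V F G) (c c' : C) :
    la F c c' ▷ X ≫ rapp f c' = (α_ _ _ _).hom ≫ EHom V c c' ◁ rapp f c ≫ la G c c' :=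
  (isVNatural_iff_rf _).1 ((natπ_natural F G).precomp f) c c'

lemma lapp_rc {X Y : V} (g : Y ⟶ EHom V G H) (f : X ⟶ EHom V F G) (c : C) :
    lapp (rc g f) c = (α_ _ _ _).hom ≫ Y ◁ lapp f c ≫ lapp g c := by
  have h : rc g f ≫ natπ F H c = rc (g ≫ natπ G H c) (f ≫ natπ F G c) :=
    (Category.assoc _ _ _).trans (congrArg ((β_ Y X).hom ≫ ·) (ecmp_natπ f g c))
  rw [lapp, h, lf_rc, lapp, lapp]

/-- A family `X ⊗ F c ⟶ G c` compatible with the right actions is a generalised element of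
`[C, V](F, G)`. -/
def lMk {X : V} (s : ∀ c, X ⊗ F.obj c ⟶ G.obj c)
    (h : ∀ c c', X ◁ ra F c c' ≫ s c' = (α_ _ _ _).inv ≫ s c ▷ EHom V c c' ≫ ra G c c') :
    X ⟶ EHom V F G :=
  natLift (fun c => lfInv (s c)) ((isVNatural_iff_lf _).2 fun c c' => by
    rw [lf_lfInv, lf_lfInv, h])

lemma lapp_lMk {X : V} (s : ∀ c, X ⊗ F.obj c ⟶ G.obj c)
    (h : ∀ c c', X ◁ ra F c c' ≫ s c' = (α_ _ _ _).inv ≫ s c ▷ EHom V c c' ≫ ra G c c') (c : C) :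
    lapp (lMk s h) c = s c := by
  rw [lapp, lMk, natLift_π, lf_lfInv]

/-- A family `F c ⊗ X ⟶ G c` compatible with the left actions is a generalised element of
`[C, V](F, G)`. -/
def rMk {X : V} (s : ∀ c, F.obj c ⊗ X ⟶ G.obj c)
    (h : ∀ c c', la F c c' ▷ X ≫ s c' = (α_ _ _ _).hom ≫ EHom V c c' ◁ s c ≫ la G c c') :
    X ⟶ EHom V F G :=
  natLift (fun c => rfInv (s c)) ((isVNatural_iff_rf _).2 fun c c' => by
    rw [rf_rfInv, rf_rfInv, h])

lemma rapp_rMk {X : V} (s : ∀ c, F.obj c ⊗ X ⟶ G.obj c)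
    (h : ∀ c c', la F c c' ▷ X ≫ s c' = (α_ _ _ _).hom ≫ EHom V c c' ◁ s c ≫ la G c c') (c : C) :
    rapp (rMk s h) c = s c := by
  rw [rapp, rMk, natLift_π, rf_rfInv]

lemma gapp_natural (φ : 𝟙_ V ⟶ EHom V F G) (c c' : C) :
    la F c c' ≫ gapp φ c' = EHom V c c' ◁ gapp φ c ≫ la G c c' := by
  have h : ∀ c, gapp φ c = (ρ_ _).inv ≫ rapp φ c := fun c => by
    rw [gapp, lf, rapp]
    simp
  rw [h, h, rightUnitor_inv_naturality_assoc, rapp_natural]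
  simp

end NaturalTransformations

section Coend

variable {V : Type u} [Category.{v} V] [MonoidalCategory V] [SymmetricCategory V]
  [MonoidalClosed V] {A : Type w} [EnrichedCategory V A]

/-- The left action `A(a, a') ⊗ F a' ⟶ F a` of a presheaf `F : Aᵒᵖ ⟶ V`. -/
def pla (F : EnrichedFunctor V Aᵒᵖ V) (a a' : A) :
    EHom V a a' ⊗ F.obj (op a') ⟶ F.obj (op a) := la F (op a') (op a)

/-- A family `X ⊗ (G a ⊗ F a) ⟶ Q` is balanced if it is dinatural in `a`: it equalises the action
of `A` on `G` and that on `F`. -/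
def Balanced (G : EnrichedFunctor V A V) (F : EnrichedFunctor V Aᵒᵖ V) {X Q : V}
    (s : ∀ a, X ⊗ (G.obj a ⊗ F.obj (op a)) ⟶ Q) : Prop :=
  ∀ a a', X ◁ ra G a a' ▷ F.obj (op a') ≫ s a' =
    X ◁ ((α_ _ _ _).hom ≫ G.obj a ◁ pla F a a') ≫ s a

/-- The family `w` exhibits `Q` as the coend `∫^a G a ⊗ F a`. -/
structure IsCoend (G : EnrichedFunctor V A V) (F : EnrichedFunctor V Aᵒᵖ V) {Q : V}
    (w : ∀ a, G.obj a ⊗ F.obj (op a) ⟶ Q) : Prop where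
  balanced : ∀ a a', ra G a a' ▷ F.obj (op a') ≫ w a' =
    (α_ _ _ _).hom ≫ G.obj a ◁ pla F a a' ≫ w a
  desc : ∀ (v : V) (s : ∀ a, G.obj a ⊗ F.obj (op a) ⟶ v),
    (∀ a a', ra G a a' ▷ F.obj (op a') ≫ s a' = (α_ _ _ _).hom ≫ G.obj a ◁ pla F a a' ≫ s a) →
      ∃! h : Q ⟶ v, ∀ a, w a ≫ h = s a

variable {G : EnrichedFunctor V A V} {F : EnrichedFunctor V Aᵒᵖ V} {Q : V}
  {w : ∀ a, G.obj a ⊗ F.obj (op a) ⟶ Q}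

lemma IsCoend.hom_ext (hw : IsCoend G F w) {v : V} {f g : Q ⟶ v}
    (h : ∀ a, w a ≫ f = w a ≫ g) : f = g := by
  obtain ⟨k, -, hk⟩ := hw.desc v (fun a => w a ≫ g) fun a a' => by
    rw [← Category.assoc, hw.balanced]
    simp
  rw [hk f h, hk g fun _ => rfl]

/-- A morphism out of `X ⊗ Q` is determined on the summands of the coend `Q`, since `V` is closed. -/
lemma IsCoend.hom_ext_left (hw : IsCoend G F w) {X v : V} {f g : X ⊗ Q ⟶ v}
    (h : ∀ a, X ◁ w a ≫ f = X ◁ w a ≫ g) : f = g := by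
  have : (rfInv f : Q ⟶ EHom V X v) = rfInv g := hw.hom_ext fun a => rf_injective (by
    rw [rf_comp, rf_comp, rf_rfInv, rf_rfInv, h])
  rw [← rf_rfInv f, this, rf_rfInv]

lemma IsCoend.hom_ext_middle (hw : IsCoend G F w) {X Y v : V} {f g : (X ⊗ Q) ⊗ Y ⟶ v}
    (h : ∀ a, (X ◁ w a) ▷ Y ≫ f = (X ◁ w a) ▷ Y ≫ g) : f = g := by
  have : (lfInv f : X ⊗ Q ⟶ EHom V Y v) = lfInv g :=
    hw.hom_ext_left fun a => lf_injective (by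
      rw [lf_comp, lf_comp, lf_lfInv, lf_lfInv, h])
  rw [← lf_lfInv f, this, lf_lfInv]

/-- Coends are preserved by `X ⊗ -`, since `V` is closed. -/
lemma IsCoend.desc_left (hw : IsCoend G F w) {X v : V}
    (s : ∀ a, X ⊗ (G.obj a ⊗ F.obj (op a)) ⟶ v) (hs : Balanced G F s) :
    ∃! h : X ⊗ Q ⟶ v, ∀ a, X ◁ w a ≫ h = s a := by
  obtain ⟨k, hk, -⟩ := hw.desc (EHom V X v) (fun a => rfInv (s a)) fun a a' => rf_injective (by
    rw [rf_comp, ← Category.assoc, rf_comp, rf_rfInv, rf_rfInv]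
    exact hs a a')
  refine ⟨rf k, fun a => ?_, fun h' hh => hw.hom_ext_left fun a => ?_⟩
  · rw [← rf_comp, hk, rf_rfInv]
  · rw [hh, ← rf_comp, hk, rf_rfInv]

end Coend

/-! ### The Yoneda lemma and the Kan extension wedge -/

section Yoneda

variable {V : Type u} [Category.{v} V] [MonoidalCategory V] [SymmetricCategory V]
  [MonoidalClosed V] [HasLimitsOfSize.{w, w} V] {A : Type w} [EnrichedCategory V A]

/-- The representable `A(a, -)`, as a value of the Yoneda embedding `Aᵒᵖ ⟶ [A, V]`. -/
abbrev yob (V : Type u) [Category.{v} V] [MonoidalCategory V] [SymmetricCategory V]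
    [MonoidalClosed V] [HasLimitsOfSize.{w, w} V] {A : Type w} [EnrichedCategory V A] (a : A) :
    EnrichedFunctor V A V := (yonedaV A).obj (op a)

/-- The action `A(a, a') ⟶ [A, V](A(a', -), A(a, -))` of the Yoneda embedding. -/
def ymap (a a' : A) : EHom V a a' ⟶ EHom V (yob V a') (yob V a) :=
  (yonedaV A).map (op a') (op a)

/-- The components `X ⊗ A(a, c) ⟶ G c` of a generalised element of `[A, V](A(a, -), G)`. -/
def ylapp {X : V} {a : A} {G : EnrichedFunctor V A V} (f : X ⟶ EHom V (yob V a) G) (c : A) :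
    X ⊗ EHom V a c ⟶ G.obj c := lapp f c

/-- The components `X ⊗ H c ⟶ A(a, c)` of a generalised element of `[A, V](H, A(a, -))`. -/
def lappy {X : V} {a : A} {H : EnrichedFunctor V A V} (f : X ⟶ EHom V H (yob V a)) (c : A) :
    X ⊗ H.obj c ⟶ EHom V a c := lapp f c

/-- The components `X ⊗ A(a, c) ⟶ A(a', c)` of a generalised element of
`[A, V](A(a, -), A(a', -))`. -/
def ylappy {X : V} {a a' : A} (f : X ⟶ EHom V (yob V a) (yob V a')) (c : A) :
    X ⊗ EHom V a c ⟶ EHom V a' c := lapp f c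

variable {X Y : V} {a : A} {G H : EnrichedFunctor V A V}

lemma ylapp_ext {f g : X ⟶ EHom V (yob V a) G} (h : ∀ c, ylapp f c = ylapp g c) : f = g :=
  lapp_ext h

lemma ylapp_comp (h : Y ⟶ X) (f : X ⟶ EHom V (yob V a) G) (c : A) :
    ylapp (h ≫ f) c = h ▷ EHom V a c ≫ ylapp f c :=
  lapp_comp h f c

lemma ylapp_natural (f : X ⟶ EHom V (yob V a) G) (c c' : A) : X ◁ eComp V a c c' ≫ ylapp f c' =
    (α_ _ _ _).inv ≫ ylapp f c ▷ EHom V c c' ≫ ra G c c' :=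
  (congrArg (fun t => X ◁ t ≫ ylapp f c') (ra_coyo a c c').symm).trans (lapp_natural f c c')

lemma ylapp_rc (g : Y ⟶ EHom V H G) (f : X ⟶ EHom V (yob V a) H) (c : A) :
    ylapp (rc g f) c = (α_ _ _ _).hom ≫ Y ◁ ylapp f c ≫ lapp g c :=
  lapp_rc g f c

lemma ylapp_rc' {a' : A} (g : Y ⟶ EHom V (yob V a') G) (f : X ⟶ EHom V (yob V a) (yob V a'))
    (c : A) : ylapp (rc g f) c = (α_ _ _ _).hom ≫ Y ◁ ylappy f c ≫ ylapp g c :=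
  lapp_rc g f c

lemma lappy_comp (h : Y ⟶ X) (f : X ⟶ EHom V H (yob V a)) (c : A) :
    lappy (h ≫ f) c = h ▷ H.obj c ≫ lappy f c :=
  lapp_comp h f c

lemma lappy_natural (f : X ⟶ EHom V H (yob V a)) (c c' : A) : X ◁ ra H c c' ≫ lappy f c' =
    (α_ _ _ _).inv ≫ lappy f c ▷ EHom V c c' ≫ eComp V a c c' :=
  (lapp_natural f c c').trans
    (congrArg (fun t => (α_ _ _ _).inv ≫ lappy f c ▷ EHom V c c' ≫ t) (ra_coyo a c c'))

lemma lapp_rc_yob (g : Y ⟶ EHom V (yob V a) G) (f : X ⟶ EHom V H (yob V a)) (c : A) :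
    lapp (rc g f) c = (α_ _ _ _).hom ≫ Y ◁ lappy f c ≫ ylapp g c :=
  lapp_rc g f c

lemma lappy_rc (g : Y ⟶ EHom V G (yob V a)) (f : X ⟶ EHom V H G) (c : A) :
    lappy (rc g f) c = (α_ _ _ _).hom ≫ Y ◁ lapp f c ≫ lappy g c :=
  lapp_rc g f c

lemma lappy_rc' {a' : A} (g : Y ⟶ EHom V (yob V a') (yob V a)) (f : X ⟶ EHom V H (yob V a'))
    (c : A) : lappy (rc g f) c = (α_ _ _ _).hom ≫ Y ◁ lappy f c ≫ ylappy g c :=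
  lapp_rc g f c

/-- The Yoneda morphism `G a ⟶ [A, V](A(a, -), G)`. -/
def yo (G : EnrichedFunctor V A V) (a : A) : G.obj a ⟶ EHom V (yob V a) G :=
  lMk (F := coyo a) (fun c => ra G a c) fun c c' => by
    rw [ra_coyo]
    exact ra_comp G a c c'

lemma ylapp_yo (G : EnrichedFunctor V A V) (a c : A) : ylapp (yo G a) c = ra G a c :=
  lapp_lMk (F := coyo a) _ _ c

lemma ylappy_ymap (a a' c : A) : ylappy (ymap (V := V) a a') c = eComp V a a' c := by
  have h : (yonedaV A).map (op a') (op a) ≫ natπ (coyo (V := V) a') (coyo a) c =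
      coyoMap a' a c := natLift_π _ (coyoMap_natural a' a) c
  exact (congrArg lf h).trans (lf_coyoMap a' a c)

/-- The Yoneda morphism of a representable is the action of the Yoneda embedding. -/
lemma yo_yob (a a' : A) : yo (yob V a) a' = ymap (V := V) a a' :=
  ylapp_ext fun c => (ylapp_yo _ _ _).trans ((ra_coyo a a' c).trans (ylappy_ymap a a' c).symm)

/-- The evaluation at the identity, `[A, V](A(a, -), G) ⟶ G a`. -/
def yoInv (G : EnrichedFunctor V A V) (a : A) : EHom V (yob V a) G ⟶ G.obj a :=
  (ρ_ _).inv ≫ EHom V (yob V a) G ◁ eId V a ≫ ylapp (𝟙 (EHom V (yob V a) G)) a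

lemma yo_yoInv (G : EnrichedFunctor V A V) (a : A) : yo G a ≫ yoInv G a = 𝟙 _ := by
  rw [yoInv, rightUnitor_inv_naturality_assoc, ← whisker_exchange_assoc, ← ylapp_comp,
    Category.comp_id, ylapp_yo, ra_id, Iso.inv_hom_id]

lemma yoInv_yo (G : EnrichedFunctor V A V) (a : A) : yoInv G a ≫ yo G a = 𝟙 _ := by
  refine ylapp_ext fun c => ?_
  have h := ylapp_natural (𝟙 (EHom V (yob V a) G)) a c
  have hid := e_id_comp V a c
  rw [Iso.inv_comp_eq, Category.comp_id] at hid
  rw [Iso.eq_inv_comp] at h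
  rw [ylapp_comp, ylapp_yo, yoInv, comp_whiskerRight_assoc, comp_whiskerRight_assoc, ← h,
    associator_naturality_middle_assoc, ← MonoidalCategory.whiskerLeft_comp_assoc, hid]
  simp

instance (G : EnrichedFunctor V A V) (a : A) : IsIso (yo G a) :=
  ⟨yoInv G a, yo_yoInv G a, yoInv_yo G a⟩

/-- The Yoneda morphism is `V`-natural in `a`. -/
lemma ra_yo (G : EnrichedFunctor V A V) (a a' : A) :
    ra G a a' ≫ yo G a' = rc (yo G a) (ymap a a') := by
  refine ylapp_ext fun c => ?_
  rw [ylapp_comp, ylapp_yo, ylapp_rc', ylapp_yo, ylappy_ymap, ra_comp, Iso.hom_inv_id_assoc]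

end Yoneda

section KanExtensions

variable {V : Type u} [Category.{v} V] [MonoidalCategory V] [SymmetricCategory V]
  [MonoidalClosed V] [HasLimitsOfSize.{w, w} V] {A : Type w} [EnrichedCategory V A]
  (F : EnrichedFunctor V Aᵒᵖ V) (L : EnrichedFunctor V (EnrichedFunctor V A V) V)
  (φ : 𝟙_ V ⟶ EHom V F ((yonedaV A).comp V L))

/-- The component `F a ⟶ L (A(a, -))` of `φ`. -/
def kanUnit (a : A) : F.obj (op a) ⟶ L.obj (yob V a) := gapp φ (op a)

lemma kanUnit_natural (a a' : A) : pla F a a' ≫ kanUnit F L φ a =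
    EHom V a a' ◁ kanUnit F L φ a' ≫
      lf (ymap a a' ≫ L.map _ _) :=
  gapp_natural φ (op a') (op a)

/-- The morphism `G a ⊗ F a ⟶ L G` obtained from `φ` and the action of `L`. -/
def kanWedge (G : EnrichedFunctor V A V) (a : A) : G.obj a ⊗ F.obj (op a) ⟶ L.obj G :=
  G.obj a ◁ kanUnit F L φ a ≫ lf (yo G a ≫ L.map _ _)

lemma kanWedge_balanced (G : EnrichedFunctor V A V) (a a' : A) :
    ra G a a' ▷ F.obj (op a') ≫ kanWedge F L φ G a' =
      (α_ _ _ _).hom ≫ G.obj a ◁ pla F a a' ≫ kanWedge F L φ G a := by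
  rw [kanWedge, kanWedge, ← whisker_exchange_assoc, ← lf_comp, ← Category.assoc (ra G a a'), ra_yo,
    rc_map, lf_rc, ← MonoidalCategory.whiskerLeft_comp_assoc, kanUnit_natural]
  simp

/-- The component `[A, V](A(a, -), G) ⟶ [F a, L G]` of the cocone defining the Kan extension. -/
def kanApp (G : EnrichedFunctor V A V) (a : A) :
    EHom V (yob V a) G ⟶ EHom V (F.obj (op a)) (L.obj G) :=
  (kanCocone (yonedaV A) F L φ G).app (op (op a))

lemma lf_kanApp (G : EnrichedFunctor V A V) (a : A) :
    lf (kanApp F L φ G a) = EHom V (yob V a) G ◁ kanUnit F L φ a ≫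
      lf (L.map (yob V a) G) := by
  have h1 : ∀ {X x : V} (z : 𝟙_ V ⟶ EHom V (F.obj (op a)) x) (f : X ⟶ EHom V x (L.obj G)),
      lf (f ≫ (λ_ _).inv ≫ lf (X := 𝟙_ V) (x := EHom V x (L.obj G))
        (y := EHom V (F.obj (op a)) (L.obj G))
        (z ≫ (coyo (V := V) (op (L.obj G))).map (op x) (op (F.obj (op a))))) =
      X ◁ ((λ_ _).inv ≫ lf z) ≫ lf f := by
    intro X x z f
    have e : rf (X := 𝟙_ V) (x := EHom V x (L.obj G)) (y := EHom V (F.obj (op a)) (L.obj G))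
        (z ≫ (coyo (V := V) (op (L.obj G))).map (op x) (op (F.obj (op a)))) =
        rc (𝟙 (EHom V x (L.obj G))) z := by
      refine (rf_comp _ _).trans ?_
      refine (congrArg (EHom V x (L.obj G) ◁ z ≫ ·) (ra_coyo _ _ _)).trans ?_
      exact (ecmp_id_whisker (B := Vᵒᵖ) (a := op (L.obj G)) (b := op x)
        (c := op (F.obj (op a))) z).symm.trans (ecmp_op (C := V) (𝟙 (EHom V x (L.obj G))) z)
    rw [lf.eq_1 (X := 𝟙_ V) (x := EHom V x (L.obj G)), e, braiding_rc, lf_comp, lf_ecmp_unit,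
      ← whisker_exchange_assoc, ← lf_comp, Category.comp_id]
  have h2 : kanApp F L φ G a = L.map (yob V a) G ≫ (λ_ _).inv ≫
      lf (X := 𝟙_ V) (x := EHom V (L.obj (yob V a)) (L.obj G))
        (y := EHom V (F.obj (op a)) (L.obj G))
        ((φ ≫ natπ F ((yonedaV A).comp V L) (op a)) ≫
          (coyo (V := V) (op (L.obj G))).map (op (L.obj (yob V a)))
            (op (F.obj (op a)))) := by
    refine (gapp_comp _ _ _).trans (congrArg₂ (· ≫ ·) ?_ (gapp_natLift _ _ _))
    refine (gapp_natLift _ _ _).trans ?_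
    exact (congrArg _ (lf_curry' _)).trans (Iso.inv_hom_id_assoc _ _)
  rw [h2]
  exact h1 (φ ≫ natπ F ((yonedaV A).comp V L) (op a)) _

end KanExtensions

/-! ### Kan extensions along the Yoneda embedding as coends -/

section KanExtensions

variable {V : Type u} [Category.{v} V] [MonoidalCategory V] [SymmetricCategory V]
  [MonoidalClosed V] [HasLimitsOfSize.{w, w} V] {A : Type w} [EnrichedCategory V A]
  (F : EnrichedFunctor V Aᵒᵖ V) (L : EnrichedFunctor V (EnrichedFunctor V A V) V)
  (φ : 𝟙_ V ⟶ EHom V F ((yonedaV A).comp V L)) (G : EnrichedFunctor V A V)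

/-- The universal property of the pointwise Kan extension, unfolded. -/
lemma isLimit_kanCocone_iff : (kanCocone (yonedaV A) F L φ G).IsLimit ↔
    ∀ (v X : V) (τ : ∀ a : A, X ⊗ EHom V (yob V a) G ⟶ EHom V (F.obj (op a)) v),
      (∀ a a', X ◁ rc (𝟙 (EHom V (yob V a) G)) (ymap a a') ≫ τ a' =
        (α_ _ _ _).inv ≫ rc (τ a) (F.map (op a') (op a))) →
      ∃! g : X ⟶ EHom V (L.obj G) v, ∀ a, rc g (kanApp F L φ G a) = τ a := by
  refine (isLimit_iff_left _).trans ?_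
  have hra : ∀ a a' : A, ra ((opFunctor (yonedaV A)).comp V (coyo (V := V) (op G))) (op (op a))
      (op (op a')) = rc (𝟙 (EHom V (yob V a) G)) (ymap a a') := fun a a' =>
    (ra_comp_coyo (opFunctor (yonedaV A)) (op G) (op (op a)) (op (op a'))).trans
      (ecmp_op (C := EnrichedFunctor V A V) (𝟙 (EHom V (yob V a) G)) (ymap a a'))
  constructor
  · intro h v X τ hτ
    obtain ⟨g, hg, hu⟩ := h (op v) X (fun k => τ k.unop.unop) fun k k' =>
      (congrArg (fun t => X ◁ t ≫ τ k'.unop.unop) (hra k.unop.unop k'.unop.unop)).trans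
        ((hτ k.unop.unop k'.unop.unop).trans
          (congrArg ((α_ _ _ _).inv ≫ ·) (ecmp_op (C := V) _ _).symm))
    exact ⟨g, fun a => (ecmp_op (C := V) g (kanApp F L φ G a)).symm.trans (hg (op (op a))),
      fun g' hg' => hu g' fun k =>
        (ecmp_op (C := V) g' (kanApp F L φ G k.unop.unop)).trans (hg' k.unop.unop)⟩
  · intro h v X τ hτ
    obtain ⟨g, hg, hu⟩ := h v.unop X (fun a => τ (op (op a))) fun a a' =>
      (congrArg (fun t => X ◁ t ≫ τ (op (op a'))) (hra a a').symm).trans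
        ((hτ (op (op a)) (op (op a'))).trans
          (congrArg ((α_ _ _ _).inv ≫ ·) (ecmp_op (C := V) _ _)))
    exact ⟨g, fun k => (ecmp_op (C := V) g (kanApp F L φ G k.unop.unop)).trans (hg k.unop.unop),
      fun g' hg' => hu g' fun a =>
        (ecmp_op (C := V) g' (kanApp F L φ G a)).symm.trans (hg' (op (op a)))⟩

/-- The transpose of a family `X ⊗ [A, V](A(a, -), G) ⟶ [F a, v]` under the Yoneda lemma. -/
def yoTranspose {X v : V} {a : A} (τ : X ⊗ EHom V (yob V a) G ⟶ EHom V (F.obj (op a)) v) :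
    X ⊗ (G.obj a ⊗ F.obj (op a)) ⟶ v :=
  (α_ _ _ _).inv ≫ (X ◁ yo G a) ▷ F.obj (op a) ≫ lf τ

/-- The inverse of `yoTranspose`. -/
def yoTransposeInv {X v : V} {a : A} (s : X ⊗ (G.obj a ⊗ F.obj (op a)) ⟶ v) :
    X ⊗ EHom V (yob V a) G ⟶ EHom V (F.obj (op a)) v :=
  lfInv ((α_ _ _ _).hom ≫ X ◁ inv (yo G a) ▷ F.obj (op a) ≫ s)

lemma yoTranspose_yoTransposeInv {X v : V} {a : A} (s : X ⊗ (G.obj a ⊗ F.obj (op a)) ⟶ v) :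
    yoTranspose F G (yoTransposeInv F G s) = s := by
  simp [yoTranspose, yoTransposeInv, ← MonoidalCategory.whiskerLeft_comp_assoc,
    ← comp_whiskerRight]

lemma yoTranspose_injective {X v : V} {a : A}
    {τ τ' : X ⊗ EHom V (yob V a) G ⟶ EHom V (F.obj (op a)) v}
    (h : yoTranspose F G τ = yoTranspose F G τ') : τ = τ' := by
  rw [yoTranspose, yoTranspose, cancel_epi, cancel_epi] at h
  exact lf_injective h

lemma balanced_yoTranspose_iff {X v : V}
    (τ : ∀ a : A, X ⊗ EHom V (yob V a) G ⟶ EHom V (F.obj (op a)) v) :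
    Balanced G F (fun a => yoTranspose F G (τ a)) ↔
      ∀ a a', X ◁ rc (𝟙 (EHom V (yob V a) G)) (ymap a a') ≫ τ a' =
        (α_ _ _ _).inv ≫ rc (τ a) (F.map (op a') (op a)) := by
  refine forall₂_congr fun a a' => ?_
  have e1 : (α_ _ _ _).inv ≫ (X ◁ yo G a ▷ EHom V a a') ▷ F.obj (op a') ≫
      lf (X ◁ rc (𝟙 (EHom V (yob V a) G)) (ymap a a') ≫ τ a') =
      X ◁ ra G a a' ▷ F.obj (op a') ≫ yoTranspose F G (τ a') := by
    have h : yo G a ▷ EHom V a a' ≫ rc (𝟙 (EHom V (yob V a) G)) (ymap a a') =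
        ra G a a' ≫ yo G a' := by
      rw [ra_yo, ← rc_whiskerRight, Category.comp_id]
    rw [lf_comp, ← comp_whiskerRight_assoc, ← MonoidalCategory.whiskerLeft_comp, h, yoTranspose]
    simp
  have e2 : (α_ _ _ _).inv ≫ (X ◁ yo G a ▷ EHom V a a') ▷ F.obj (op a') ≫
      lf ((α_ X (EHom V (yob V a) G) (EHom V a a')).inv ≫ rc (τ a) (F.map (op a') (op a))) =
      X ◁ ((α_ _ _ _).hom ≫ G.obj a ◁ pla F a a') ≫ yoTranspose F G (τ a) := by
    have h : lf (rc (τ a) (F.map (op a') (op a))) = (α_ _ (EHom V a a') _).hom ≫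
        _ ◁ pla F a a' ≫ lf (τ a) := lf_rc _ _
    rw [lf_comp]
    refine (congrArg (fun t => (α_ _ _ _).inv ≫ (X ◁ yo G a ▷ EHom V a a') ▷ F.obj (op a') ≫
      (α_ X (EHom V (yob V a) G) (EHom V a a')).inv ▷ F.obj (op a') ≫ t) h).trans ?_
    have hx := whisker_exchange (yo G a) (pla F a a')
    rw [yoTranspose]
    simp only [MonoidalCategory.whiskerLeft_comp, Category.assoc,
      MonoidalCategory.whisker_assoc, Iso.inv_hom_id_assoc, tensor_whiskerLeft]
    rw [← MonoidalCategory.whiskerLeft_comp_assoc X _ (yo G a ▷ _), hx]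
    simp
  rw [← e1, ← e2]
  constructor
  · intro h
    rw [cancel_epi, cancel_epi] at h
    exact lf_injective h
  · intro h
    rw [h]
    rfl

lemma yoTranspose_rc_kanApp {X v : V} (g : X ⟶ EHom V (L.obj G) v) (a : A) :
    yoTranspose F G (rc g (kanApp F L φ G a)) = X ◁ kanWedge F L φ G a ≫ lf g := by
  have h : yo G a ▷ F.obj (op a) ≫ lf (kanApp F L φ G a) = kanWedge F L φ G a := by
    rw [lf_kanApp, kanWedge, lf_comp, whisker_exchange_assoc]
  rw [yoTranspose, lf_rc, ← h]
  simp

/-- The pointwise left Kan extension of `F` along the Yoneda embedding has the values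
`L G = ∫^a G a ⊗ F a`. -/
lemma isLimit_kanCocone_iff_isCoend :
    (kanCocone (yonedaV A) F L φ G).IsLimit ↔ IsCoend G F (kanWedge F L φ G) := by
  have key : (kanCocone (yonedaV A) F L φ G).IsLimit ↔
      ∀ (v X : V) (s : ∀ a : A, X ⊗ (G.obj a ⊗ F.obj (op a)) ⟶ v), Balanced G F s →
        ∃! h : X ⊗ L.obj G ⟶ v, ∀ a, X ◁ kanWedge F L φ G a ≫ h = s a := by
    refine (isLimit_kanCocone_iff F L φ G).trans (forall₂_congr fun v X => ?_)
    constructor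
    · intro H s hs
      have hs' : (fun a => yoTranspose F G (yoTransposeInv F G (s a))) = s :=
        funext fun a => yoTranspose_yoTransposeInv F G (s a)
      obtain ⟨g, hg, hu⟩ := H (fun a => yoTransposeInv F G (s a))
        ((balanced_yoTranspose_iff F G _).1 (hs'.symm ▸ hs))
      refine ⟨lf g, fun a => ?_, fun h' hh => ?_⟩
      · rw [← yoTranspose_rc_kanApp, hg, yoTranspose_yoTransposeInv]
      · rw [← hu (lfInv h') fun a => yoTranspose_injective F G ?_, lf_lfInv]
        rw [yoTranspose_rc_kanApp, lf_lfInv, hh, yoTranspose_yoTransposeInv]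
    · intro H τ hτ
      obtain ⟨h, hh, hu⟩ := H _ ((balanced_yoTranspose_iff F G τ).2 hτ)
      refine ⟨lfInv h, fun a => yoTranspose_injective F G ?_, fun g' hg' => lf_injective ?_⟩
      · rw [yoTranspose_rc_kanApp, lf_lfInv, hh]
      · rw [lf_lfInv]
        exact hu _ fun a => by rw [← yoTranspose_rc_kanApp, hg']
  rw [key]
  constructor
  · intro H
    refine ⟨kanWedge_balanced F L φ G, fun v s hs => ?_⟩
    obtain ⟨h, hh, hu⟩ := H v (𝟙_ V) (fun a => (λ_ _).hom ≫ s a) fun a a' => by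
      have := hs a a'
      simp [this]
    refine ⟨(λ_ _).inv ≫ h, fun a => ?_, fun h' hh' => ?_⟩
    · rw [leftUnitor_inv_naturality_assoc, hh, Iso.inv_hom_id_assoc]
    · rw [Iso.eq_inv_comp]
      exact hu _ fun a => by rw [leftUnitor_naturality_assoc, hh']
  · intro H v X s hs
    exact H.desc_left s hs

end KanExtensions

/-! ### Presheaves with a right adjoint, and coends -/

section DualPair

variable {V : Type u} [Category.{v} V] [MonoidalCategory V] [SymmetricCategory V]
  [MonoidalClosed V] {A : Type w} [EnrichedCategory V A]

/-- A pairing `F b ⊗ N a ⟶ A(b, a)` compatible with both actions of `A`. -/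
structure Pairing (F : EnrichedFunctor V Aᵒᵖ V) (N : EnrichedFunctor V A V) where
  ε : ∀ b a, F.obj (op b) ⊗ N.obj a ⟶ EHom V b a
  ε_left : ∀ b b' a, pla F b b' ▷ N.obj a ≫ ε b a =
    (α_ _ _ _).hom ≫ EHom V b b' ◁ ε b' a ≫ eComp V b b' a
  ε_right : ∀ b a a', F.obj (op b) ◁ ra N a a' ≫ ε b a' =
    (α_ _ _ _).inv ≫ ε b a ▷ EHom V a a' ≫ eComp V b a a'

/-- An adjunction between a presheaf `F`, viewed as a module `I ⇸ A`, and a `V`-functor `N : A ⟶ V`,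
viewed as a module `A ⇸ I`. The object `Q` is the coend `∫^a N a ⊗ F a`, with unit `u : 𝟙_ V ⟶ Q`
and counit `ε : F b ⊗ N a ⟶ A(b, a)`; the morphisms `t` and `s` are the actions of `Q` on `F` and
`N` which occur in the triangle identities. -/
structure DualPair (F : EnrichedFunctor V Aᵒᵖ V) (N : EnrichedFunctor V A V)
    extends Pairing F N where
  Q : V
  ι : ∀ a, N.obj a ⊗ F.obj (op a) ⟶ Q
  isCoend : IsCoend N F ι
  u : 𝟙_ V ⟶ Q
  t : ∀ b, F.obj (op b) ⊗ Q ⟶ F.obj (op b)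
  ι_t : ∀ b b', F.obj (op b) ◁ ι b' ≫ t b =
    (α_ _ _ _).inv ≫ ε b b' ▷ F.obj (op b') ≫ pla F b b'
  u_t : ∀ b, F.obj (op b) ◁ u ≫ t b = (ρ_ _).hom
  s : ∀ b, Q ⊗ N.obj b ⟶ N.obj b
  ι_s : ∀ b b', ι b' ▷ N.obj b ≫ s b = (α_ _ _ _).hom ≫ N.obj b' ◁ ε b' b ≫ ra N b' b
  u_s : ∀ b, u ▷ N.obj b ≫ s b = (λ_ _).hom

variable [HasLimitsOfSize.{w, w} V]
  {F : EnrichedFunctor V Aᵒᵖ V} {N : EnrichedFunctor V A V} (d : DualPair F N)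

/-- If `F` has a right adjoint `N`, then `∫^a G a ⊗ F a` exists and is `[A, V](N, G)`. -/
lemma DualPair.isCoend_nat (G : EnrichedFunctor V A V)
    (w : ∀ a, G.obj a ⊗ F.obj (op a) ⟶ EHom V N G)
    (hb : ∀ a a', ra G a a' ▷ F.obj (op a') ≫ w a' = (α_ _ _ _).hom ≫ G.obj a ◁ pla F a a' ≫ w a)
    (hw : ∀ a c, lapp (w a) c = (α_ _ _ _).hom ≫ G.obj a ◁ d.ε a c ≫ ra G a c) :
    IsCoend G F w := by
  -- evaluation followed by a balanced family is balanced, hence induces `[A, V](N, G) ⊗ Q ⟶ v`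
  have hev : ∀ (v : V) (f : ∀ a, G.obj a ⊗ F.obj (op a) ⟶ v),
      (∀ a a', ra G a a' ▷ F.obj (op a') ≫ f a' = (α_ _ _ _).hom ≫ G.obj a ◁ pla F a a' ≫ f a) →
      Balanced N F (X := EHom V N G)
        (fun a => (α_ _ _ _).inv ≫ lapp (𝟙 (EHom V N G)) a ▷ F.obj (op a) ≫ f a) := by
    intro v f hf a a'
    have h1 := lapp_natural (𝟙 (EHom V N G)) a a'
    have hx := whisker_exchange (lapp (𝟙 (EHom V N G)) a) (pla F a a')
    calc EHom V N G ◁ ra N a a' ▷ F.obj (op a') ≫ (α_ _ _ _).inv ≫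
          lapp (𝟙 (EHom V N G)) a' ▷ F.obj (op a') ≫ f a'
        = (α_ _ _ _).inv ≫ (EHom V N G ◁ ra N a a' ≫ lapp (𝟙 (EHom V N G)) a') ▷
            F.obj (op a') ≫ f a' := by simp
      _ = (α_ _ _ _).inv ≫ (α_ _ _ _).inv ▷ _ ≫ (α_ _ _ _).hom ≫
            (lapp (𝟙 (EHom V N G)) a ▷ (EHom V a a' ⊗ F.obj (op a')) ≫
              G.obj a ◁ pla F a a') ≫ f a := by
          rw [h1, comp_whiskerRight_assoc, comp_whiskerRight_assoc, hf]
          simp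
      _ = _ := by
          rw [← hx]
          simp
  refine ⟨hb, fun v f hf => ?_⟩
  obtain ⟨p, hp, -⟩ := d.isCoend.desc_left _ (hev v f hf)
  refine ⟨(ρ_ _).inv ≫ EHom V N G ◁ d.u ≫ p, fun a => ?_, fun h' hh => ?_⟩
  · have key : w a ▷ d.Q ≫ p = (α_ _ _ _).hom ≫ G.obj a ◁ d.t a ≫ f a := by
      refine d.isCoend.hom_ext_left fun c => ?_
      have h1 : w a ▷ N.obj c ≫ lapp (𝟙 (EHom V N G)) c = lapp (w a) c := by
        rw [← lapp_comp, Category.comp_id]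
      calc (G.obj a ⊗ F.obj (op a)) ◁ d.ι c ≫ w a ▷ d.Q ≫ p
          = w a ▷ (N.obj c ⊗ F.obj (op c)) ≫ (α_ _ _ _).inv ≫
              lapp (𝟙 (EHom V N G)) c ▷ F.obj (op c) ≫ f c := by
            rw [whisker_exchange_assoc, hp]
        _ = (α_ _ _ _).inv ≫ (w a ▷ N.obj c ≫ lapp (𝟙 (EHom V N G)) c) ▷ F.obj (op c) ≫ f c := by
            simp
        _ = (α_ _ _ _).hom ≫ G.obj a ◁ ((α_ _ _ _).inv ≫
              d.ε a c ▷ F.obj (op c) ≫ pla F a c) ≫ f a := by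
            rw [h1, hw, comp_whiskerRight_assoc, comp_whiskerRight_assoc, hf]
            simp
        _ = _ := by
            rw [← d.ι_t]
            simp
    rw [rightUnitor_inv_naturality_assoc, ← whisker_exchange_assoc, key, tensor_whiskerLeft_assoc,
      Iso.inv_hom_id_assoc, ← MonoidalCategory.whiskerLeft_comp_assoc, d.u_t]
    simp
  · -- the identity of `[A, V](N, G)` factors through the wedge `w`
    obtain ⟨q, hq, -⟩ := d.isCoend.desc_left _ (hev _ w hb)
    have hid : (ρ_ _).inv ≫ EHom V N G ◁ d.u ≫ q = 𝟙 (EHom V N G) := by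
      refine lapp_ext fun c => ?_
      have key : lapp q c = (α_ _ _ _).hom ≫ EHom V N G ◁ d.s c ≫ lapp (𝟙 (EHom V N G)) c := by
        refine d.isCoend.hom_ext_middle fun a => ?_
        have hn := lapp_natural (𝟙 (EHom V N G)) a c
        have hx := whisker_exchange (lapp (𝟙 (EHom V N G)) a) (d.ε a c)
        calc (EHom V N G ◁ d.ι a) ▷ N.obj c ≫ lapp q c
            = (α_ _ _ _).inv ▷ _ ≫ (α_ _ _ _).hom ≫
                (lapp (𝟙 (EHom V N G)) a ▷ (F.obj (op a) ⊗ N.obj c) ≫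
                  G.obj a ◁ d.ε a c) ≫ ra G a c := by
              rw [← lapp_comp, hq, lapp_comp, lapp_comp, hw]
              simp
          _ = (α_ _ _ _).hom ≫ EHom V N G ◁ ((α_ _ _ _).hom ≫ N.obj a ◁ d.ε a c ≫ ra N a c) ≫
                lapp (𝟙 (EHom V N G)) c := by
              rw [← hx]
              simp only [MonoidalCategory.whiskerLeft_comp, Category.assoc]
              rw [hn]
              simp
          _ = _ := by
              rw [← d.ι_s]
              simp
      rw [lapp_comp, lapp_comp, key, associator_naturality_middle_assoc,
        ← MonoidalCategory.whiskerLeft_comp_assoc, d.u_s]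
      simp
    have hqp : q ≫ h' = p := d.isCoend.hom_ext_left fun a => by
      rw [reassoc_of% hq, hp, hh]
    rw [← hqp, reassoc_of% hid]

end DualPair

/-! ### Presheaves with a right adjoint are flat -/

section Flatness

variable {V : Type u} [Category.{v} V] [MonoidalCategory V] [SymmetricCategory V]
  [MonoidalClosed V] [HasLimitsOfSize.{w, w} V]

/-- A family `F c ⟶ G c` compatible with the left actions is a global element of `[C, V](F, G)`. -/
def gMk {C : Type w} [EnrichedCategory V C] {F G : EnrichedFunctor V C V}
    (s : ∀ c, F.obj c ⟶ G.obj c)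
    (h : ∀ c c', la F c c' ≫ s c' = EHom V c c' ◁ s c ≫ la G c c') : 𝟙_ V ⟶ EHom V F G :=
  rMk (fun c => (ρ_ _).hom ≫ s c) fun c c' => by
    rw [rightUnitor_naturality_assoc, h]
    simp

lemma gapp_gMk {C : Type w} [EnrichedCategory V C] {F G : EnrichedFunctor V C V}
    (s : ∀ c, F.obj c ⟶ G.obj c)
    (h : ∀ c c', la F c c' ≫ s c' = EHom V c c' ◁ s c ≫ la G c c') (c : C) :
    gapp (gMk s h) c = s c := by
  have e : rf (gMk s h ≫ natπ F G c) = (ρ_ _).hom ≫ s c := rapp_rMk _ _ c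
  rw [gapp, lf, e]
  simp

variable {A : Type w} [EnrichedCategory V A]

/-- A family `X ⊗ N a ⟶ A(b, a)` compatible with the actions of `A` from the right is a generalised
element of `[A, V](N, A(b, -))`. -/
def lMky {N : EnrichedFunctor V A V} {X : V} {b : A} (s : ∀ a, X ⊗ N.obj a ⟶ EHom V b a)
    (h : ∀ a a', X ◁ ra N a a' ≫ s a' = (α_ _ _ _).inv ≫ s a ▷ EHom V a a' ≫ eComp V b a a') :
    X ⟶ EHom V N (yob V b) :=
  lMk (G := coyo b) s fun a a' => by
    rw [ra_coyo]
    exact h a a'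

lemma lappy_lMky {N : EnrichedFunctor V A V} {X : V} {b : A} (s : ∀ a, X ⊗ N.obj a ⟶ EHom V b a)
    (h : ∀ a a', X ◁ ra N a a' ≫ s a' = (α_ _ _ _).inv ≫ s a ▷ EHom V a a' ≫ eComp V b a a')
    (a : A) : lappy (lMky s h) a = s a :=
  lapp_lMk (G := coyo b) s _ a

lemma lappy_ext {N : EnrichedFunctor V A V} {X : V} {b : A} {f g : X ⟶ EHom V N (yob V b)}
    (h : ∀ c, lappy f c = lappy g c) : f = g :=
  lapp_ext h

lemma lappy_rc_ymap {N : EnrichedFunctor V A V} {X : V} {b b' : A} (f : X ⟶ EHom V N (yob V b'))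
    (c : A) : lappy (rc (ymap b b') f) c =
      (α_ _ _ _).hom ≫ EHom V b b' ◁ lappy f c ≫ eComp V b b' c := by
  rw [lappy_rc', ylappy_ymap]

variable {F : EnrichedFunctor V Aᵒᵖ V} {N : EnrichedFunctor V A V}

namespace Pairing

variable (d : Pairing F N)

/-- The transpose `F b ⟶ [A, V](N, A(b, -))` of a pairing. -/
def counitMap (b : A) : F.obj (op b) ⟶ EHom V N (yob V b) :=
  lMky (fun a => d.ε b a) (d.ε_right b)

lemma lappy_counitMap (b a : A) : lappy (d.counitMap b) a = d.ε b a :=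
  lappy_lMky _ _ a

lemma counitMap_natural (b b' : A) :
    pla F b b' ≫ d.counitMap b = rc (ymap b b') (d.counitMap b') := by
  refine lappy_ext fun c => ?_
  rw [lappy_comp, lappy_rc_ymap, lappy_counitMap, lappy_counitMap, d.ε_left]

/-- The `V`-natural transformation `F ⟶ [A, V](N, Y -)` with components `counitMap`. -/
def unitNat : 𝟙_ V ⟶ EHom V F ((yonedaV A).comp V (coyo N)) :=
  gMk (G := (yonedaV A).comp V (coyo N)) (fun b => d.counitMap b.unop) fun b b' => by
    refine (d.counitMap_natural b'.unop b.unop).trans ?_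
    exact (rc_eq _ _).trans (congrArg (EHom V b'.unop b.unop ◁ d.counitMap b.unop ≫ ·)
      (la_comp_coyo (yonedaV A) N b b').symm)

lemma app_unitNat (b : A) : WeightedCone.app (P := F) (G := yonedaV A) (L := N) d.unitNat (op b) =
    d.counitMap b :=
  gapp_gMk _ _ _

lemma kanUnit_unitNat (b : A) : kanUnit F (coyo N) d.unitNat b = d.counitMap b :=
  gapp_gMk _ _ _

end Pairing

lemma DualPair.lapp_kanWedge (d : DualPair F N) (G : EnrichedFunctor V A V) (a c : A) :
    lapp (F := N) (G := G) (kanWedge F (coyo N) d.unitNat G a) c =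
      (α_ _ _ _).hom ≫ G.obj a ◁ d.ε a c ≫ ra G a c := by
  have h1 : lf (yo G a ≫ (coyo (V := V) N).map (yob V a) G) = rc (yo G a) (𝟙 _) := by
    refine (lf_comp _ _).trans ?_
    refine (congrArg (yo G a ▷ EHom V N (yob V a) ≫ ·) (la_coyo N (yob V a) G)).trans ?_
    refine (rc_whiskerRight (yo G a) (𝟙 (EHom V (yob V a) G)) (𝟙 (EHom V N (yob V a)))).symm.trans ?_
    rw [Category.comp_id]
  have h2 : kanWedge F (coyo N) d.unitNat G a = rc (yo G a) (d.counitMap a) := by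
    refine Eq.trans ?_ (rc_eq _ _).symm
    exact congrArg₂ (fun p q => G.obj a ◁ p ≫ q) (d.kanUnit_unitNat a) h1
  refine (congrArg (fun t => lapp (F := N) (G := G) t c) h2).trans ?_
  rw [lapp_rc_yob, Pairing.lappy_counitMap, ylapp_yo]

/-- A presheaf with a right adjoint `N` is flat: its left Kan extension along the Yoneda embedding
is represented by `N`, and representable `V`-functors preserve limits. -/
lemma DualPair.isFlat (d : DualPair F N) : IsFlat (allIndexes.{w} V) F :=
  ⟨coyo N, d.unitNat, fun G => (isLimit_kanCocone_iff_isCoend F (coyo N) d.unitNat G).2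
    (d.isCoend_nat G _ (kanWedge_balanced F (coyo N) d.unitNat G) (d.lapp_kanWedge G)),
    fun _ _ W _ G => preservesWeightedLimit_coyo N W G⟩

end Flatness

/-! ### Module adjunctions and dual pairs -/

section Modules

variable {V : Type u} [Category.{v} V] [MonoidalCategory V] [SymmetricCategory V]
  [MonoidalClosed V] {A : Type w} [EnrichedCategory V A]

/-- The object of the unit `V`-category. -/
def unitPt : UnitVCat := ()

/-- A `V`-functor `N : A ⟶ V` viewed as a module `A ⇸ I`. -/
def copresheafModule (N : EnrichedFunctor V A V) : VModule V A UnitVCat where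
  obj _ a := N.obj a
  lact _ _ a := (λ_ (N.obj a)).hom
  ract _ a a' := ra N a a'
  id_lact _ a := by
    change 𝟙 _ ▷ _ ≫ _ = _
    simp
  comp_lact _ _ _ a := by
    change (λ_ (𝟙_ V)).hom ▷ _ ≫ _ = (α_ (𝟙_ V) (𝟙_ V) _).hom ≫ 𝟙_ V ◁ _ ≫ _
    simp
  ract_id _ a := ra_id N a
  ract_comp _ a a' a'' := ra_comp N a a' a''
  lact_ract _ _ a a' := by
    change (λ_ _).hom ▷ _ ≫ _ = (α_ (𝟙_ V) _ _).hom ≫ 𝟙_ V ◁ _ ≫ (λ_ _).hom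
    simp

/-- A module `A ⇸ I` viewed as a `V`-functor `A ⟶ V`. -/
def moduleFunctor (M : VModule V A UnitVCat) : EnrichedFunctor V A V where
  obj a := M.obj unitPt a
  map a a' := rfInv (M.ract unitPt a a')
  map_id a := rf_injective (by
    rw [rf_comp, rf_rfInv, M.ract_id, rf_eId])
  map_comp a b c := rf_injective (by
    rw [rf_comp, rf_rfInv, M.ract_comp]
    exact ((rf_ecmp _ _).trans (by rw [rf_rfInv, rf_rfInv])).symm)

lemma ra_moduleFunctor (M : VModule V A UnitVCat) (a a' : A) :
    ra (moduleFunctor M) a a' = M.ract unitPt a a' := rf_rfInv _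

/-- The data of a right adjoint module of a presheaf, in terms of `V`-functors. -/
def dualPairOfAdjunction {F : EnrichedFunctor V Aᵒᵖ V} {M : VModule V A UnitVCat}
    (adj : VModule.Adjunction (presheafModule F) M) : DualPair F (moduleFunctor M) where
  Q := adj.NM.comp.obj unitPt unitPt
  ι a := adj.NM.ι unitPt a unitPt
  isCoend := by
    refine ⟨fun a a' => ?_, fun v s hs => ?_⟩
    · rw [ra_moduleFunctor]
      exact adj.NM.balanced unitPt a a' unitPt
    · refine adj.NM.desc unitPt unitPt v s fun a a' => ?_
      have h := hs a a'
      rw [ra_moduleFunctor] at h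
      exact h
  u := adj.unit.app unitPt unitPt
  ε b a := adj.MN.ι b unitPt a ≫ adj.counit.app b a
  ε_left b b' a := by
    have h1 := adj.MN.ι_lact b b' unitPt a
    have h2 := adj.counit.lact_app b b' a
    have h3 := congrArg (· ≫ adj.counit.app b a) h1
    simp only [Category.assoc] at h3
    rw [h2, ← MonoidalCategory.whiskerLeft_comp_assoc, Iso.eq_inv_comp] at h3
    exact h3.symm
  ε_right b a a' := by
    have h1 := adj.MN.ι_ract b unitPt a a'
    have h2 := adj.counit.ract_app b a a'
    have h3 := congrArg (· ≫ adj.counit.app b a') h1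
    simp only [Category.assoc] at h3
    rw [h2, ← comp_whiskerRight_assoc, ← Iso.inv_comp_eq] at h3
    rw [ra_moduleFunctor]
    exact h3.symm
  t b := (adj.left_triangle b unitPt unitPt).choose
  ι_t b b' := (adj.left_triangle b unitPt unitPt).choose_spec.1 b'
  u_t b := (adj.left_triangle b unitPt unitPt).choose_spec.2
  s b := (adj.right_triangle unitPt unitPt b).choose
  ι_s b b' := by
    rw [ra_moduleFunctor]
    exact (adj.right_triangle unitPt unitPt b).choose_spec.1 b'
  u_s b := (adj.right_triangle unitPt unitPt b).choose_spec.2.trans (by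
    have h := M.id_lact unitPt b
    change 𝟙 (𝟙_ V) ▷ _ ≫ _ = _ at h
    rwa [id_whiskerRight, Category.id_comp] at h)

variable {F : EnrichedFunctor V Aᵒᵖ V} {N : EnrichedFunctor V A V} (d : DualPair F N)

namespace DualPair

/-- The module `I ⇸ I` given by the object `Q`. -/
def unitModule (Q : V) : VModule V UnitVCat UnitVCat where
  obj _ _ := Q
  lact _ _ _ := (λ_ Q).hom
  ract _ _ _ := (ρ_ Q).hom
  id_lact _ _ := by
    change 𝟙 _ ▷ _ ≫ _ = _
    simp
  comp_lact _ _ _ _ := by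
    change (λ_ (𝟙_ V)).hom ▷ _ ≫ _ = (α_ (𝟙_ V) (𝟙_ V) _).hom ≫ 𝟙_ V ◁ _ ≫ _
    simp
  ract_id _ _ := by
    change _ ◁ 𝟙 _ ≫ _ = _
    simp
  ract_comp _ _ _ _ := by
    change _ ◁ (λ_ (𝟙_ V)).hom ≫ _ = (α_ _ (𝟙_ V) (𝟙_ V)).inv ≫ (ρ_ Q).hom ▷ 𝟙_ V ≫ _
    rw [← MonoidalCategory.triangle_assoc, Iso.inv_hom_id_assoc]
  lact_ract _ _ _ _ := by
    change (λ_ Q).hom ▷ 𝟙_ V ≫ _ = (α_ (𝟙_ V) Q (𝟙_ V)).hom ≫ 𝟙_ V ◁ _ ≫ _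
    simp

/-- The composite `I ⇸ A ⇸ I` is given by the coend `Q`. -/
def compositeNF : VModule.Composite (copresheafModule N) (presheafModule F) where
  comp := unitModule d.Q
  ι _ a _ := d.ι a
  balanced _ a a' _ := d.isCoend.balanced a a'
  ι_lact _ _ a _ := by
    change 𝟙_ V ◁ d.ι a ≫ (λ_ d.Q).hom = (α_ (𝟙_ V) _ _).inv ≫ (λ_ _).hom ▷ _ ≫ d.ι a
    simp
  ι_ract _ a _ _ := by
    change d.ι a ▷ 𝟙_ V ≫ (ρ_ d.Q).hom = (α_ _ _ (𝟙_ V)).hom ≫ _ ◁ (ρ_ _).hom ≫ d.ι a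
    simp
  desc _ _ X f hf := d.isCoend.desc X f hf

variable (F N) in
/-- The composite `A ⇸ I ⇸ A` of `N` and `F`, with values `F b ⊗ N a`. -/
def compositeFN : VModule.Composite (presheafModule F) (copresheafModule N) where
  comp :=
    { obj := fun b a => F.obj (op b) ⊗ N.obj a
      lact := fun b b' a => (α_ _ _ _).inv ≫ pla F b b' ▷ N.obj a
      ract := fun b a a' => (α_ _ _ _).hom ≫ F.obj (op b) ◁ ra N a a'
      id_lact := fun b a => by
        have h : eId V b ▷ F.obj (op b) ≫ pla F b b = (λ_ _).hom :=
          (presheafModule F).id_lact b unitPt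
        rw [associator_inv_naturality_left_assoc, ← comp_whiskerRight, h]
        simp
      comp_lact := fun b b' b'' a => by
        have h : eComp V b b' b'' ▷ F.obj (op b'') ≫ pla F b b'' =
            (α_ _ _ _).hom ≫ EHom V b b' ◁ pla F b' b'' ≫ pla F b b' :=
          (presheafModule F).comp_lact b b' b'' unitPt
        rw [associator_inv_naturality_left_assoc, ← comp_whiskerRight, h]
        simp
      ract_id := fun b a => by
        rw [associator_naturality_right_assoc, ← MonoidalCategory.whiskerLeft_comp, ra_id]
        simp
      ract_comp := fun b a a' a'' => by
        rw [associator_naturality_right_assoc, ← MonoidalCategory.whiskerLeft_comp, ra_comp]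
        simp
      lact_ract := fun b b' a a' => by
        have hx := whisker_exchange (pla F b b') (ra N a a')
        simp only [comp_whiskerRight, MonoidalCategory.whiskerLeft_comp, Category.assoc,
          associator_naturality_left_assoc, associator_inv_naturality_right_assoc, hx]
        simp }
  ι b _ a := 𝟙 _
  balanced b _ _ a := by
    change (ρ_ (F.obj (op b))).hom ▷ N.obj a ≫ 𝟙 _ =
      (α_ _ (𝟙_ V) _).hom ≫ F.obj (op b) ◁ (λ_ (N.obj a)).hom ≫ 𝟙 _
    simp
  ι_lact b b' _ a := by
    change _ ◁ 𝟙 _ ≫ (α_ _ _ _).inv ≫ pla F b b' ▷ N.obj a =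
      (α_ _ _ _).inv ≫ pla F b b' ▷ N.obj a ≫ 𝟙 _
    simp
  ι_ract b _ a a' := by
    change 𝟙 _ ▷ _ ≫ (α_ _ _ _).hom ≫ F.obj (op b) ◁ ra N a a' =
      (α_ _ _ _).hom ≫ F.obj (op b) ◁ ra N a a' ≫ 𝟙 _
    simp
  desc b a X f _ := ⟨f unitPt, fun _ => Category.id_comp _, fun g hg =>
    (Category.id_comp _).symm.trans (hg unitPt)⟩

/-- The module adjunction given by a dual pair. -/
def adjunction : VModule.Adjunction (presheafModule F) (copresheafModule N) where
  NM := d.compositeNF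
  MN := compositeFN F N
  unit :=
    { app := fun _ _ => d.u
      lact_app := fun _ _ _ => by
        change (λ_ (𝟙_ V)).hom ≫ d.u = 𝟙_ V ◁ d.u ≫ (λ_ d.Q).hom
        simp
      ract_app := fun _ _ _ => by
        change (λ_ (𝟙_ V)).hom ≫ d.u = d.u ▷ 𝟙_ V ≫ (ρ_ d.Q).hom
        simp [unitors_equal] }
  counit :=
    { app := fun b a => d.ε b a
      lact_app := fun b b' a => by
        change ((α_ _ _ _).inv ≫ pla F b b' ▷ N.obj a) ≫ d.ε b a =
          EHom V b b' ◁ d.ε b' a ≫ eComp V b b' a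
        rw [Category.assoc, d.ε_left, Iso.inv_hom_id_assoc]
      ract_app := fun b a a' => by
        change ((α_ _ _ _).hom ≫ F.obj (op b) ◁ ra N a a') ≫ d.ε b a' =
          d.ε b a ▷ EHom V a a' ≫ eComp V b a a'
        rw [Category.assoc, d.ε_right, Iso.hom_inv_id_assoc] }
  left_triangle b _ _ := ⟨d.t b, fun b' => by
    refine (d.ι_t b b').trans ?_
    exact congrArg (fun x => (α_ _ _ _).inv ≫ x ▷ F.obj (op b') ≫ pla F b b')
      (Category.id_comp (d.ε b b')).symm, d.u_t b⟩
  right_triangle _ _ b := ⟨d.s b, fun b' => by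
    refine (d.ι_s b b').trans ?_
    exact congrArg (fun x => (α_ _ _ _).hom ≫ N.obj b' ◁ x ≫ ra N b' b)
      (Category.id_comp (d.ε b' b)).symm, d.u_s b⟩

end DualPair

/-- A presheaf is a left adjoint module if and only if it is part of a dual pair. -/
lemma isLeftAdjoint_presheafModule_iff (F : EnrichedFunctor V Aᵒᵖ V) :
    (presheafModule F).IsLeftAdjoint ↔ ∃ N : EnrichedFunctor V A V, Nonempty (DualPair F N) :=
  ⟨fun ⟨M, ⟨adj⟩⟩ => ⟨moduleFunctor M, ⟨dualPairOfAdjunction adj⟩⟩,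
    fun ⟨N, ⟨d⟩⟩ => ⟨copresheafModule N, ⟨d.adjunction⟩⟩⟩

end Modules

/-! ### The candidate right adjoint of a presheaf -/

section DoubleOpposite

variable {V : Type u} [Category.{v} V] [MonoidalCategory V] [SymmetricCategory V]
  (A : Type u₁) [EnrichedCategory V A]

/-- The identification of `A` with `Aᵒᵖᵒᵖ`. -/
def opOpFunctor : EnrichedFunctor V A Aᵒᵖᵒᵖ where
  obj a := op (op a)
  map a a' := 𝟙 (EHom V a a')
  map_id a := Category.comp_id _
  map_comp a b c := by
    change eComp V a b c ≫ 𝟙 _ =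
      (𝟙 (EHom V a b) ⊗ₘ 𝟙 (EHom V b c)) ≫ (β_ _ _).hom ≫ (β_ _ _).hom ≫ eComp V a b c
    simp

end DoubleOpposite

section Dual

variable {V : Type u} [Category.{v} V] [MonoidalCategory V] [SymmetricCategory V]
  [MonoidalClosed V] [HasLimitsOfSize.{w, w} V]

lemma rapp_ecmp {C : Type w} [EnrichedCategory V C] {F G H : EnrichedFunctor V C V} {X Y : V}
    (f : X ⟶ EHom V F G) (g : Y ⟶ EHom V G H) (c : C) :
    rapp (ecmp f g) c = (α_ _ _ _).inv ≫ rapp f c ▷ Y ≫ rapp g c := by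
  rw [rapp, ecmp_natπ, rf_ecmp, rapp, rapp]

variable {A : Type w} [EnrichedCategory V A] (F : EnrichedFunctor V Aᵒᵖ V)

/-- The `V`-functor `a ↦ [Aᵒᵖ, V](F, A(-, a))`, the candidate right adjoint of `F`. -/
def dualFunctor : EnrichedFunctor V A V :=
  ((opOpFunctor A).comp V (yonedaV Aᵒᵖ)).comp V (coyo F)

/-- The evaluation pairing `F b ⊗ [Aᵒᵖ, V](F, A(-, a)) ⟶ A(b, a)`. -/
def dualEv (b a : A) : F.obj (op b) ⊗ (dualFunctor F).obj a ⟶ EHom V b a :=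
  rapp (G := coyo (op a)) (𝟙 (EHom V F (coyo (V := V) (op a)))) (op b)

variable {F}

lemma rapp_eq_dualEv {X : V} {a : A} (f : X ⟶ (dualFunctor F).obj a) (b : A) :
    rapp (F := F) (G := coyo (op a)) f (op b) = F.obj (op b) ◁ f ≫ dualEv F b a := by
  refine Eq.trans ?_ (rapp_comp (F := F) (G := coyo (op a)) f (𝟙 _) (op b))
  exact congrArg (fun t => rapp (F := F) (G := coyo (op a)) t (op b)) (Category.comp_id f).symm

lemma dual_ext {X : V} {a : A} {f g : X ⟶ (dualFunctor F).obj a}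
    (h : ∀ b, F.obj (op b) ◁ f ≫ dualEv F b a = F.obj (op b) ◁ g ≫ dualEv F b a) : f = g :=
  rapp_ext (F := F) (G := coyo (op a)) fun b => by
    have := h b.unop
    rw [← rapp_eq_dualEv, ← rapp_eq_dualEv] at this
    exact this

lemma la_coyo_op (a b b' : A) :
    la (coyo (V := V) (op a)) (op b') (op b) = eComp V b b' a := by
  refine (la_coyo (B := Aᵒᵖ) (op a) (op b') (op b)).trans ?_
  change (β_ _ _).hom ≫ (𝟙 (EHom V b' a) ⊗ₘ 𝟙 (EHom V b b')) ≫ (β_ _ _).hom ≫ eComp V b b' a = _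
  simp

lemma exists_dualLift {X : V} {a : A} (s : ∀ b, F.obj (op b) ⊗ X ⟶ EHom V b a)
    (hs : ∀ b b', pla F b b' ▷ X ≫ s b =
      (α_ _ _ _).hom ≫ EHom V b b' ◁ s b' ≫ eComp V b b' a) :
    ∃ f : X ⟶ (dualFunctor F).obj a, ∀ b, F.obj (op b) ◁ f ≫ dualEv F b a = s b := by
  let f : X ⟶ EHom V F (coyo (V := V) (op a)) := rMk (fun b => s b.unop) fun b b' => by
    refine (hs b'.unop b.unop).trans ?_
    exact congrArg (fun t => (α_ _ _ _).hom ≫ EHom V b'.unop b.unop ◁ s b.unop ≫ t)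
      (la_coyo_op a b'.unop b.unop).symm
  refine ⟨f, fun b => (rapp_eq_dualEv (F := F) (a := a) f b).symm.trans ?_⟩
  exact rapp_rMk (F := F) (G := coyo (op a)) _ _ (op b)

variable (F) in
/-- The evaluation pairing is compatible with both actions of `A`. -/
def dualPairing : Pairing F (dualFunctor F) where
  ε := dualEv F
  ε_left b b' a := by
    refine (rapp_natural (F := F) (G := coyo (op a)) (𝟙 _) (op b') (op b)).trans ?_
    exact congrArg (fun t => (α_ _ _ _).hom ≫ EHom V b b' ◁ dualEv F b' a ≫ t)
      (la_coyo_op a b b')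
  ε_right b a a' := by
    have h1 : ra (dualFunctor F) a a' = ecmp (𝟙 (EHom V F (coyo (V := V) (op a))))
        (((opOpFunctor A).comp V (yonedaV Aᵒᵖ)).map a a') := ra_comp_coyo _ _ _ _
    have h2 : rapp (F := coyo (V := V) (op a)) (G := coyo (op a'))
        (((opOpFunctor A).comp V (yonedaV Aᵒᵖ)).map a a') (op b) = eComp V b a a' := by
      have h3 : ((opOpFunctor (V := V) A).comp V (yonedaV Aᵒᵖ)).map a a' ≫
          natπ (coyo (V := V) (op a)) (coyo (op a')) (op b) = coyoMap (op a) (op a') (op b) := by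
        refine Eq.trans ?_ (natLift_π _ (coyoMap_natural (op a) (op a')) (op b))
        exact congrArg (· ≫ natπ (coyo (V := V) (op a)) (coyo (op a')) (op b))
          (Category.id_comp _)
      refine (congrArg rf h3).trans ?_
      refine (braiding_lf _).symm.trans ?_
      refine (congrArg ((β_ _ _).hom ≫ ·) (lf_coyoMap (op a) (op a') (op b))).trans ?_
      change (β_ (EHom V b a) (EHom V a a')).hom ≫ (β_ _ _).hom ≫ eComp V b a a' = _
      simp
    refine (rapp_eq_dualEv (F := F) (a := a') (ra (dualFunctor F) a a') b).symm.trans ?_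
    refine (congrArg (fun t => rapp (F := F) (G := coyo (op a')) t (op b)) h1).trans ?_
    refine (rapp_ecmp (F := F) (G := coyo (op a)) (H := coyo (op a')) _ _ (op b)).trans ?_
    exact congrArg (fun t => (α_ _ _ _).inv ≫ dualEv F b a ▷ EHom V a a' ≫ t) h2

end Dual

/-! ### Flat presheaves have right adjoints -/

section FlatIsLeftAdjoint

variable {V : Type u} [Category.{v} V] [MonoidalCategory V] [SymmetricCategory V]
  [MonoidalClosed V] [HasLimitsOfSize.{w, w} V]
  {A : Type w} [EnrichedCategory V A] (F : EnrichedFunctor V Aᵒᵖ V)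

/-- The cone with vertex `a ↦ [Aᵒᵖ, V](F, A(-, a))` given by the evaluation pairing is the limit
of the Yoneda embedding weighted by `F`. -/
lemma isLimit_dualPairing :
    WeightedCone.IsLimit (P := F) (G := yonedaV A) (L := dualFunctor F)
      (dualPairing F).unitNat := by
  rw [isLimit_iff_right]
  intro H X τ hτ
  have happ : ∀ b : A, WeightedCone.app (P := F) (G := yonedaV A) (L := dualFunctor F)
      (dualPairing F).unitNat (op b) = (dualPairing F).counitMap b :=
    fun b => (dualPairing F).app_unitNat b
  let τ' : ∀ b : A, F.obj (op b) ⊗ X ⟶ EHom V H (yob V b) := fun b => τ (op b)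
  have hτ' : ∀ b b', pla F b b' ▷ X ≫ τ' b = (α_ _ _ _).hom ≫ rc (ymap b b') (τ' b') :=
    fun b b' => hτ (op b') (op b)
  have hcomp : ∀ (g : X ⟶ EHom V H (dualFunctor F)) (b c : A),
      lappy (rc ((dualPairing F).counitMap b) g) c =
        (α_ _ _ _).hom ≫ F.obj (op b) ◁ lapp g c ≫ dualEv F b c := fun g b c => by
    rw [lappy_rc, Pairing.lappy_counitMap]
    rfl
  have hl : ∀ c : A, ∃ l : X ⊗ H.obj c ⟶ (dualFunctor F).obj c,
      ∀ b, F.obj (op b) ◁ l ≫ dualEv F b c = (α_ _ _ _).inv ≫ lappy (τ' b) c := fun c => by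
    refine exists_dualLift _ fun b b' => ?_
    have h := congrArg (fun t => lappy t c) (hτ' b b')
    simp only [lappy_comp, lappy_rc_ymap] at h
    rw [associator_inv_naturality_left_assoc, h]
    simp
  choose l hl using hl
  have hnat : ∀ c c', X ◁ ra H c c' ≫ l c' =
      (α_ _ _ _).inv ≫ l c ▷ EHom V c c' ≫ ra (dualFunctor F) c c' := fun c c' => by
    refine dual_ext fun b => ?_
    have h1 := lappy_natural (τ' b) c c'
    have h2 := (dualPairing F).ε_right b c c'
    change _ ≫ dualEv F b c' = _ ≫ dualEv F b c ▷ _ ≫ _ at h2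
    simp only [MonoidalCategory.whiskerLeft_comp, Category.assoc]
    rw [hl, h2, associator_inv_naturality_right_assoc, h1,
      associator_inv_naturality_middle_assoc, ← comp_whiskerRight_assoc, hl]
    simp
  refine ⟨lMk l hnat, fun b => ?_, fun g' hg' => lapp_ext fun c => dual_ext fun b => ?_⟩
  · refine (congrArg (fun t => rc t (lMk l hnat)) (happ b.unop)).trans ?_
    refine lappy_ext fun c => ?_
    rw [hcomp, lapp_lMk, hl, Iso.hom_inv_id_assoc]
  · have h := (congrArg (fun t => rc t g') (happ b)).symm.trans (hg' (op b))
    have h' := congrArg (fun t => lappy t c) h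
    change lappy (rc ((dualPairing F).counitMap b) g') c = lappy (τ' b) c at h'
    rw [hcomp, ← Iso.eq_inv_comp] at h'
    rw [h', lapp_lMk, hl]

section Extension

variable (L : EnrichedFunctor V (EnrichedFunctor V A V) V)
  (φ : 𝟙_ V ⟶ EHom V F ((yonedaV A).comp V L))

/-- The left Kan extension along the (fully faithful) Yoneda embedding restricts to `F`. -/
lemma isIso_kanUnit (hL : ∀ G, IsCoend G F (kanWedge F L φ G)) (c : A) :
    IsIso (kanUnit F L φ c) := by
  have hw : ∀ a, kanWedge F L φ (yob V c) a = pla F c a ≫ kanUnit F L φ c := fun a => by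
    rw [kanUnit_natural, kanWedge, yo_yob]
    rfl
  have hid : eId V c ▷ F.obj (op c) ≫ pla F c c = (λ_ _).hom :=
    (presheafModule F).id_lact c unitPt
  obtain ⟨h, hh, -⟩ := (hL (yob V c)).desc (F.obj (op c)) (fun a => pla F c a) fun a a' => by
    have h1 : eComp V c a a' ▷ F.obj (op a') ≫ pla F c a' =
        (α_ _ _ _).hom ≫ EHom V c a ◁ pla F a a' ≫ pla F c a :=
      (presheafModule F).comp_lact c a a' unitPt
    exact (congrArg (fun t => t ▷ F.obj (op a') ≫ pla F c a') (ra_coyo c a a')).trans h1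
  have hh' : ∀ a, pla F c a ≫ kanUnit F L φ c ≫ h = pla F c a := fun a => by
    rw [← Category.assoc, ← hw]
    exact hh a
  refine ⟨h, ?_, (hL (yob V c)).hom_ext fun a => ?_⟩
  · have := congrArg (fun t => (λ_ _).inv ≫ eId V c ▷ F.obj (op c) ≫ t) (hh' c)
    simpa only [reassoc_of% hid, hid, Iso.inv_hom_id_assoc, Iso.inv_hom_id] using this
  · rw [← Category.assoc]
    refine (congrArg (· ≫ kanUnit F L φ c) (hh a)).trans ?_
    exact (hw a).symm.trans (Category.comp_id _).symm

/-- The action `F b ⊗ L N ⟶ L (A(b, -))` of `L` on the transpose of the evaluation pairing, where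
`N` is the vertex of the limit of the Yoneda embedding weighted by `F`. -/
def dualAct (b : A) : F.obj (op b) ⊗ L.obj (dualFunctor F) ⟶ L.obj (yob V b) :=
  lf ((dualPairing F).counitMap b ≫ L.map _ _)

lemma dualAct_natural (b b' : A) : pla F b b' ▷ L.obj (dualFunctor F) ≫ dualAct F L b =
    (α_ _ _ _).hom ≫ EHom V b b' ◁ dualAct F L b' ≫ lf (ymap b b' ≫ L.map _ _) := by
  rw [dualAct, ← lf_comp, ← Category.assoc, Pairing.counitMap_natural, rc_map, lf_rc, dualAct]

lemma kanWedge_dualAct (b b' : A) :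
    F.obj (op b) ◁ kanWedge F L φ (dualFunctor F) b' ≫ dualAct F L b =
      (α_ _ _ _).inv ≫ dualEv F b b' ▷ F.obj (op b') ≫ pla F b b' ≫ kanUnit F L φ b := by
  have h1 : rc ((dualPairing F).counitMap b) (yo (dualFunctor F) b') =
      dualEv F b b' ≫ ymap b b' := ylapp_ext fun c => by
    have h2 := (dualPairing F).ε_right b b' c
    rw [Iso.eq_inv_comp] at h2
    rw [ylapp_rc, ylapp_yo, ylapp_comp]
    refine (congrArg (fun t => (α_ _ _ _).hom ≫ F.obj (op b) ◁ ra (dualFunctor F) b' c ≫ t)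
      (Pairing.lappy_counitMap (dualPairing F) b c)).trans (h2.trans ?_)
    exact congrArg (dualEv F b b' ▷ EHom V b' c ≫ ·) (ylappy_ymap b b' c).symm
  have h3 := lf_rc ((dualPairing F).counitMap b ≫ L.map _ _) (yo (dualFunctor F) b' ≫ L.map _ _)
  rw [← rc_map, h1, Category.assoc, lf_comp, ← Iso.inv_comp_eq] at h3
  rw [kanUnit_natural, kanWedge, dualAct, MonoidalCategory.whiskerLeft_comp, Category.assoc, ← h3,
    associator_inv_naturality_right_assoc, whisker_exchange_assoc]

/-- If `L` preserves the limit of the Yoneda embedding weighted by `F`, then the unit of the Kan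
extension corresponds to a unit `𝟙_ V ⟶ L N`. -/
lemma exists_dualUnit
    (hL : PreservesWeightedLimit L F (yonedaV A)) :
    ∃ u : 𝟙_ V ⟶ L.obj (dualFunctor F),
      ∀ b, F.obj (op b) ◁ u ≫ dualAct F L b = (ρ_ _).hom ≫ kanUnit F L φ b := by
  have hlim := hL _ _ (isLimit_dualPairing F)
  rw [isLimit_iff_right] at hlim
  have happ : ∀ b : A, (WeightedCone.map (P := F) (G := yonedaV A) (L := dualFunctor F)
      (dualPairing F).unitNat L).app (op b) = (dualPairing F).counitMap b ≫ L.map _ _ :=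
    fun b => (WeightedCone.map_app _ _ _).trans (congrArg (· ≫ L.map _ _) ((dualPairing F).app_unitNat b))
  obtain ⟨g, hg, -⟩ := hlim (𝟙_ V) (𝟙_ V)
    (fun k => lfInv ((ρ_ _).hom ≫ (ρ_ _).hom ≫ gapp φ k)) fun k k' => lf_injective (by
      rw [lf_comp, lf_comp, lf_rc, lf_lfInv, lf_lfInv]
      change _ = (α_ _ _ _).hom ▷ _ ≫ (α_ _ _ _).hom ≫
        EHom V k k' ◁ ((ρ_ _).hom ≫ (ρ_ _).hom ≫ gapp φ k) ≫ la ((yonedaV A).comp V L) k k'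
      rw [rightUnitor_naturality_assoc, rightUnitor_naturality_assoc, gapp_natural]
      simp)
  refine ⟨(λ_ _).inv ≫ lf g, fun b => ?_⟩
  have h := (lf_rc _ _).symm.trans ((congrArg (fun r => lf (rc r g)) (happ b)).symm.trans
    ((congrArg lf (hg (op b))).trans (lf_lfInv _)))
  rw [← Iso.eq_inv_comp] at h
  rw [MonoidalCategory.whiskerLeft_comp, Category.assoc]
  refine (congrArg (F.obj (op b) ◁ (λ_ (𝟙_ V)).inv ≫ ·) h).trans ?_
  change _ ≫ _ ≫ _ ≫ _ ≫ kanUnit F L φ b = _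
  simp

/-- The dual pair obtained from a Kan extension `L` which preserves the limit of the Yoneda
embedding weighted by `F`. -/
lemma nonempty_dualPair (hL : ∀ G, IsCoend G F (kanWedge F L φ G))
    (hP : PreservesWeightedLimit L F (yonedaV A)) :
    Nonempty (DualPair F (dualFunctor F)) := by
  have hiso := isIso_kanUnit F L φ hL
  obtain ⟨x, hx⟩ := exists_dualUnit F L φ hP
  let t : ∀ b, F.obj (op b) ⊗ L.obj (dualFunctor F) ⟶ F.obj (op b) :=
    fun b => dualAct F L b ≫ inv (kanUnit F L φ b)
  have ht : ∀ b b', pla F b b' ▷ L.obj (dualFunctor F) ≫ t b =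
      (α_ _ _ _).hom ≫ EHom V b b' ◁ t b' ≫ pla F b b' := fun b b' => by
    have h : lf (ymap b b' ≫ L.map _ _) ≫ inv (kanUnit F L φ b) =
        EHom V b b' ◁ inv (kanUnit F L φ b') ≫ pla F b b' := by
      rw [IsIso.comp_inv_eq, Category.assoc, kanUnit_natural,
        ← MonoidalCategory.whiskerLeft_comp_assoc]
      simp
    rw [← Category.assoc, dualAct_natural]
    simp [t, h]
  have ιt : ∀ b b', F.obj (op b) ◁ kanWedge F L φ (dualFunctor F) b' ≫ t b =
      (α_ _ _ _).inv ≫ dualEv F b b' ▷ F.obj (op b') ≫ pla F b b' := fun b b' => by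
    rw [← Category.assoc, kanWedge_dualAct]
    simp
  have ut : ∀ b, F.obj (op b) ◁ x ≫ t b = (ρ_ _).hom := fun b => by
    rw [← Category.assoc, hx]
    simp
  have hs : ∀ b, ∃ s : L.obj (dualFunctor F) ⊗ (dualFunctor F).obj b ⟶ (dualFunctor F).obj b,
      ∀ c, F.obj (op c) ◁ s ≫ dualEv F c b =
        (α_ _ _ _).inv ≫ t c ▷ (dualFunctor F).obj b ≫ dualEv F c b := fun b => by
    refine exists_dualLift _ fun c c' => ?_
    have h := (dualPairing F).ε_left c c' b
    change _ ≫ dualEv F c b = _ ≫ _ ◁ dualEv F c' b ≫ _ at h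
    rw [associator_inv_naturality_left_assoc, ← comp_whiskerRight_assoc, ht,
      comp_whiskerRight_assoc, comp_whiskerRight_assoc, h]
    simp
  choose s hs using hs
  refine ⟨{ dualPairing F with
    Q := L.obj (dualFunctor F)
    ι := kanWedge F L φ (dualFunctor F)
    isCoend := hL _
    u := x
    t := t
    ι_t := ιt
    u_t := ut
    s := s
    ι_s := fun b b' => dual_ext fun c => ?_
    u_s := fun b => dual_ext fun c => ?_ }⟩
  · have hl := (dualPairing F).ε_left c b' b
    have hr := (dualPairing F).ε_right c b' b
    change _ ≫ dualEv F c b = _ ≫ _ ◁ dualEv F b' b ≫ _ at hl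
    change _ ≫ dualEv F c b = _ ≫ dualEv F c b' ▷ _ ≫ _ at hr
    change _ = F.obj (op c) ◁ ((α_ _ _ _).hom ≫ (dualFunctor F).obj b' ◁ dualEv F b' b ≫
      ra (dualFunctor F) b' b) ≫ _
    have hx := whisker_exchange (dualEv F c b') (dualEv F b' b)
    simp only [MonoidalCategory.whiskerLeft_comp, Category.assoc]
    rw [hs, hr, associator_inv_naturality_middle_assoc, ← comp_whiskerRight_assoc, ιt,
      comp_whiskerRight_assoc, comp_whiskerRight_assoc, hl,
      associator_inv_naturality_right_assoc, reassoc_of% hx]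
    simp
  · rw [MonoidalCategory.whiskerLeft_comp, Category.assoc, hs,
      associator_inv_naturality_middle_assoc, ← comp_whiskerRight_assoc, ut]
    simp

end Extension

/-- A presheaf whose left Kan extension along the Yoneda embedding preserves all weighted limits is
a left adjoint module, and conversely. -/
lemma isFlat_allIndexes_iff :
    IsFlat (allIndexes.{w} V) F ↔ (presheafModule F).IsLeftAdjoint := by
  rw [isLeftAdjoint_presheafModule_iff]
  constructor
  · rintro ⟨L, φ, hφ, hL⟩
    exact ⟨dualFunctor F, nonempty_dualPair F L φ
      (fun G => (isLimit_kanCocone_iff_isCoend F L φ G).1 (hφ G))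
      (hL Aᵒᵖ F trivial (yonedaV A))⟩
  · rintro ⟨N, ⟨d⟩⟩
    exact d.isFlat

end FlatIsLeftAdjoint

/-! ### Full sub-`V`-categories with the same objects -/

section FullSubcategories

variable {V : Type u} [Category.{v} V] [MonoidalCategory V] {B : Type u₁} [EnrichedCategory V B]

/-- The inclusion between full sub-`V`-categories, for `p` implying `q`. -/
def FullSub.ofLE {p q : B → Prop} (h : ∀ x, p x → q x) :
    EnrichedFunctor V (FullSub p) (FullSub q) where
  obj x := ⟨x.1, h x.1 x.2⟩
  map x y := 𝟙 (EHom V x.1 y.1)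
  map_id _ := Category.comp_id _
  map_comp x y z := (FullSub.incl (V := V) p).map_comp x y z

/-- Two `V`-functors with definitionally equal object maps are equal if their actions on
hom-objects are. -/
lemma enrichedFunctor_mk_eq {C : Type u₂} [EnrichedCategory V C] {obj : C → B}
    {map map' : ∀ x y : C, EHom V x y ⟶ EHom V (obj x) (obj y)} {h₁ h₂ h₁' h₂'}
    (h : ∀ x y, map x y = map' x y) :
    (⟨obj, map, h₁, h₂⟩ : EnrichedFunctor V C B) = ⟨obj, map', h₁', h₂'⟩ := by
  obtain rfl : map = map' := funext₂ h
  rfl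

lemma FullSub.ofLE_comp_ofLE {p q : B → Prop} (h : ∀ x, p x → q x) (h' : ∀ x, q x → p x) :
    (FullSub.ofLE (V := V) h).comp V (FullSub.ofLE h') = EnrichedFunctor.id V _ :=
  enrichedFunctor_mk_eq fun x y => Category.comp_id (𝟙 (EHom V x.1 y.1))

lemma FullSub.ofLE_comp_incl {p q : B → Prop} (h : ∀ x, p x → q x) :
    (FullSub.ofLE (V := V) h).comp V (FullSub.incl q) = FullSub.incl p :=
  enrichedFunctor_mk_eq fun x y => Category.comp_id (𝟙 (EHom V x.1 y.1))

end FullSubcategories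

end

end EnrichedFlatness

theorem mainTheorem2 {V : Type u} [Category.{v} V] [MonoidalCategory V] [SymmetricCategory V]
    [MonoidalClosed V] [HasLimitsOfSize.{w, w} V] (A : Type w) [EnrichedCategory V A] :
    (∀ F : EnrichedFunctor V Aᵒᵖ V,
      IsFlat (allIndexes.{w} V) F ↔ (presheafModule F).IsLeftAdjoint) ∧
    ∃ (S : EnrichedFunctor V (FlatCompletion (allIndexes.{w} V) A) (CauchyCompletion V A))
      (T : EnrichedFunctor V (CauchyCompletion V A) (FlatCompletion (allIndexes.{w} V) A)),
      S.comp V T = EnrichedFunctor.id V _ ∧ T.comp V S = EnrichedFunctor.id V _ ∧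
      S.comp V (FullSub.incl _) = FullSub.incl _ ∧
      T.comp V (FullSub.incl _) = FullSub.incl _ := by
  exact ⟨isFlat_allIndexes_iff, FullSub.ofLE fun F => (isFlat_allIndexes_iff F).1,
    FullSub.ofLE fun F => (isFlat_allIndexes_iff F).2, FullSub.ofLE_comp_ofLE _ _,
    FullSub.ofLE_comp_ofLE _ _, FullSub.ofLE_comp_incl _, FullSub.ofLE_comp_incl _⟩
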